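/- \textbf{Setting.} Let $R$ be a ring and let $K$ be an oriented virtual link diagram: a finite four-valent graph with classical crossings (with over/under information, hence a sign) and virtual crossings, possibly together with components carrying no crossing. Draw every crossing with both strands going upwards. The $A$-smoothing of a positive crossing and the $B$-smoothing of a negative crossing consist of a left and a right arc; the $B$-smoothing of a positive and the $A$-smoothing of a negative crossing consist of an upper and a lower arc. A state $s$ is a choice of a smoothing at every classical crossing; it determines a set of closed curves (circles), which go straight through virtual crossings. The states are the vertices of a cube, whose edges $s\to t$ change one smoothing from $A$ to $B$. The height $\beta(s)$ is the number of $B$-smoothings of $s$. To a circle $C$ with orientation $o$ one associates the free $R$-module on $1$ and $X_{C,o}$, where $X_{C,-o}=-X_{C,o}$. To a state $s$ with circles $C_1,\dots,C_k$ one associates the ordered tensor product $V_s$ of these modules: it is generated by the products $p_1\wedge\dots\wedge p_k$, one factor $p_i\in\{1,X\}$ for each circle, the circles being taken in any order and with any orientations, subject to $X_{C,-o}=-X_{C,o}$ and to $p\wedge q=-q\wedge p$ for neighbouring factors that belong to different circles. Such a product has height $\beta(s)$ and grading $\#\{i:p_i=1\}-\#\{i:p_i=X\}+\beta(s)$. Let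 $[[K]]=\bigoplus_s V_s$. At a classical crossing orient the upper right and the lower right half-edge as in the diagram, and the upper left and the lower left one oppositely; this local orientation is used to fix $X$ for the circles at that crossing. Of two arcs at the crossing the left (respectively upper) one is the first, and the right (respectively lower) one the second. The partial differential on an edge $s\to t$ that changes the smoothing at the crossing $c$ is $V_s\to V_t$ defined as follows, where the circles at $c$ are taken in the first positions, with their local orientations, and the remaining factors are unchanged: $$m(1_1\wedge 1_2)=1,\quad m(X_1\wedge 1_2)=m(1_1\wedge X_2)=X,\quad m(X_1\wedge X_2)=0$$ if two circles merge into one; $$\Delta(1)=1_1\wedge X_2+X_1\wedge 1_2,\quad \Delta(X)=X_1\wedge X_2$$ if one circle splits into two; and $0$ if one circle is transformed into one circle. Let $\partial$ be the sum of all partial differentials. \textbf{Theorem.} For every oriented virtual diagram $K$ and every ring $R$, the complex $[[K]]$ is well defined. That is: \begin{enumerate} \item for every state $s$ and every ordering and orientation of its circles, the $2^k$ products $p_1\wedge\dots\wedge p_k$ form a basis of $V_s$, and $[[K]]$ is the direct sum of its bigraded pieces $[[K]]^{i,j}$ of height $i$ and grading $j$; \item every edge of the cube is a $2\to1$, a $1\to2$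 or a $1\to1$ bifurcation, and in the first two cases a circle that passes twice through the crossing receives the same local orientation from both of its arcs; \item the above formulas define a unique partial differential on each edge of the cube; \item every $2$-face of the cube anticommutes; \item $\partial^2=0$, and $\partial$ maps $[[K]]^{i,j}$ to $[[K]]^{i+1,j}$. \end{enumerate} -/

import Mathlib

open scoped DirectSum

/-- The sign of a classical crossing of an oriented diagram.  Every crossing is drawn with both
strands going upwards; at a positive crossing the strand from the lower left to the upper right
is the overcrossing, at a negative crossing the one from the lower right to the upper left is. -/
inductive CrossingSign
  | pos
  | neg
  deriving DecidableEq

/-- Left or right position at a crossing drawn with both strands going upwards. -/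
inductive Side
  | left
  | right
  deriving DecidableEq

instance : Fintype Side := ⟨{.left, .right}, fun x => by cases x <;> simp⟩

/-- The other side. -/
def Side.flip : Side → Side
  | .left => .right
  | .right => .left

/-- An oriented virtual link diagram: a four-valent graph with classical and virtual crossings,
possibly with further components that carry no crossing at all.

Each crossing is drawn with both strands going upwards, so that it has two outgoing half-edges
(upper left, upper right) and two incoming ones (lower left, lower right); the two strands join
opposite half-edges.  The edges of the graph join each outgoing half-edge to an incoming one.
This records the crossings, their cyclic structure and the edges of the diagram.  Planarity of the
graph is not imposed: all plane diagrams are included. -/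
structure VirtualDiagram where
  /-- number of classical crossings -/
  classical : ℕ
  /-- number of virtual crossings -/
  virtual : ℕ
  /-- number of components without crossings -/
  loops : ℕ
  /-- over/under information at the classical crossings -/
  sign : Fin classical → CrossingSign
  /-- the edges: from the upper half-edges (outgoing) to the lower half-edges (incoming) -/
  next : ((Fin classical ⊕ Fin virtual) × Side) ≃ ((Fin classical ⊕ Fin virtual) × Side)

/-- The two ways of smoothing a classical crossing. -/
inductive Smoothing
  | A
  | B
  deriving DecidableEq

instance : Fintype Smoothing := ⟨{.A, .B}, fun x => by cases x <;> simp⟩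

/-- A generator of the space of a circle: `1` or `X`. -/
inductive Label
  | one
  | X
  deriving DecidableEq

instance : Fintype Label := ⟨{.one, .X}, fun x => by cases x <;> simp⟩

namespace VirtualDiagram

/-- The crossings, classical and virtual. -/
abbrev Crossing (D : VirtualDiagram) : Type := Fin D.classical ⊕ Fin D.virtual

/-- The half-edges.  A component without crossings is given one marked point, which cuts out two
half-edges `loop k true` and `loop k false` on the two sides of the point. -/
inductive Half (D : VirtualDiagram) : Type
  | upper (x : D.Crossing) (i : Side)
  | lower (x : D.Crossing) (i : Side)
  | loop (k : Fin D.loops) (b : Bool)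
  deriving DecidableEq

/-- The other half of the edge to which a half-edge belongs. -/
def edge (D : VirtualDiagram) : D.Half → D.Half
  | .upper x i => .lower (D.next (x, i)).1 (D.next (x, i)).2
  | .lower x i => .upper (D.next.symm (x, i)).1 (D.next.symm (x, i)).2
  | .loop k b => .loop k (!b)

/-- A state: a choice of smoothing at every classical crossing, i.e. a vertex of the cube. -/
abbrev State (D : VirtualDiagram) : Type := Fin D.classical → Smoothing

/-- The smoothings with a left arc and a right arc: the `A`-smoothing of a positive crossing and the
`B`-smoothing of a negative crossing.  The other two consist of an upper arc and a lower arc. -/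
def IsLeftRight : CrossingSign → Smoothing → Bool
  | .pos, .A | .neg, .B => true
  | .pos, .B | .neg, .A => false

/-- The half-edge to which a half-edge is joined, through its crossing, in the state `s`: along an
arc of the smoothing at a classical crossing, straight on at a virtual crossing. -/
def arc (D : VirtualDiagram) (s : D.State) : D.Half → D.Half
  | .upper (.inl c) i =>
      if IsLeftRight (D.sign c) (s c) then .lower (.inl c) i else .upper (.inl c) i.flip
  | .lower (.inl c) i =>
      if IsLeftRight (D.sign c) (s c) then .upper (.inl c) i else .lower (.inl c) i.flip
  | .upper (.inr v) i => .lower (.inr v) i.flip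
  | .lower (.inr v) i => .upper (.inr v) i.flip
  | .loop k b => .loop k (!b)

/-- Walk along a circle of the state `s`: enter a crossing through the half-edge `h`, leave it
along the arc of the state, and follow the edge up to the half-edge through which the next
crossing is entered. -/
def step (D : VirtualDiagram) (s : D.State) (h : D.Half) : D.Half := D.edge (D.arc s h)

/-- A half-edge `h` stands for the circle of the state `s` that passes through it, with the
orientation for which `h` points towards its crossing.  `SameOriented s h h'` says that `h` and
`h'` give the same circle with the same orientation. -/
def SameOriented (D : VirtualDiagram) (s : D.State) (h h' : D.Half) : Prop :=
  ∃ n : ℕ, (D.step s)^[n] h = h'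

/-- `h` and `h'` give the same circle with opposite orientations. -/
def OppositelyOriented (D : VirtualDiagram) (s : D.State) (h h' : D.Half) : Prop :=
  D.SameOriented s (D.arc s h) h'

/-- `h` and `h'` lie on the same circle of the state `s`. -/
def SameCircle (D : VirtualDiagram) (s : D.State) (h h' : D.Half) : Prop :=
  D.SameOriented s h h' ∨ D.OppositelyOriented s h h'

/-- The list `l` enumerates the circles of the state `s`, each exactly once, with some choice of
their orientations. -/
def Enumerates (D : VirtualDiagram) (s : D.State) (l : List D.Half) : Prop :=
  ∀ h : D.Half, ∃! i : Fin l.length, D.SameCircle s (l.get i) h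

/-- A basis monomial `p₁ ∧ ⋯ ∧ pₖ`: the circles of the state in some order, each with an
orientation and with one of the labels `1`, `X`; a pair `(h, X)` is the element `X` of the circle
of `h` with the orientation given by `h`. -/
abbrev Monomial (D : VirtualDiagram) (s : D.State) : Type :=
  {l : List (D.Half × Label) // D.Enumerates s (l.map Prod.fst)}

/-- `Rel s l l' ε` says that the monomials `l` and `l'` are identified up to the sign `ε`:
transposing neighbouring factors changes the sign, and reversing the orientation of a circle
preserves `1` and changes the sign of `X`. -/
inductive Rel (D : VirtualDiagram) (s : D.State) :
    List (D.Half × Label) → List (D.Half × Label) → ℤ → Prop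
  | swap (l a b l') : Rel D s (l ++ a :: b :: l') (l ++ b :: a :: l') (-1)
  | same (l h h' p l') (hh : D.SameOriented s h h') :
      Rel D s (l ++ (h, p) :: l') (l ++ (h', p) :: l') 1
  | reverse_one (l h h' l') (hh : D.OppositelyOriented s h h') :
      Rel D s (l ++ (h, .one) :: l') (l ++ (h', .one) :: l') 1
  | reverse_X (l h h' l') (hh : D.OppositelyOriented s h h') :
      Rel D s (l ++ (h, .X) :: l') (l ++ (h', .X) :: l') (-1)

/-- The submodule of the relations between the monomials of a state. -/
noncomputable def relations (R : Type*) [Ring R] (D : VirtualDiagram) (s : D.State) :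
    Submodule R (D.Monomial s →₀ R) :=
  Submodule.span R {y | ∃ (a b : D.Monomial s) (ε : ℤ), D.Rel s a.1 b.1 ε ∧
    y = Finsupp.single a 1 - ε • Finsupp.single b 1}

/-- The space of a state: the ordered tensor product of the spaces `⟨1, X⟩` of its circles. -/
abbrev StateSpace (R : Type*) [Ring R] (D : VirtualDiagram) (s : D.State) : Type _ :=
  (D.Monomial s →₀ R) ⧸ D.relations R s

open Classical in
/-- The element `p₁ ∧ ⋯ ∧ pₖ` of the space of the state `s`.  (It is given the value `0` if the list
does not enumerate the circles of `s`.) -/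
noncomputable def wedge (R : Type*) [Ring R] (D : VirtualDiagram) (s : D.State)
    (l : List (D.Half × Label)) : D.StateSpace R s :=
  if h : D.Enumerates s (l.map Prod.fst) then
    (D.relations R s).mkQ (Finsupp.single ⟨l, h⟩ 1)
  else 0

/-- `s → t` is the edge of the cube that changes the smoothing at `c` from `A` to `B`. -/
def CubeEdge (D : VirtualDiagram) (c : Fin D.classical) (s t : D.State) : Prop :=
  s c = .A ∧ t c = .B ∧ ∀ x, x ≠ c → t x = s x

/-- The first (left, resp. upper) circle at the crossing `c`.  In both smoothings the upper left
half-edge lies on the first arc.  The local orientation at a crossing agrees with that of the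
diagram on the upper right and the lower right half-edge and disagrees with it on the upper left
and the lower left half-edge; so the upper left half-edge points towards the crossing. -/
def first (D : VirtualDiagram) (c : Fin D.classical) : D.Half := .upper (.inl c) .left

/-- The second (right, resp. lower) circle at the crossing `c`.  In both smoothings the lower right
half-edge lies on the second arc, and in the local orientation it points towards the crossing. -/
def second (D : VirtualDiagram) (c : Fin D.classical) : D.Half := .lower (.inl c) .right

/-- Only one circle of the state `s` touches the crossing `c`. -/
def OneCircleAt (D : VirtualDiagram) (c : Fin D.classical) (s : D.State) : Prop :=
  D.SameCircle s (D.first c) (D.second c)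

/-- `φ` is the multiplication `m` at the crossing `c`, applied to the two circles at `c`, taken in
the first two positions with their local orientations; all other circles are unchanged. -/
structure IsMultiplication (R : Type*) [Ring R] (D : VirtualDiagram) (c : Fin D.classical)
    (s t : D.State) (φ : D.StateSpace R s →ₗ[R] D.StateSpace R t) : Prop where
  one_one : ∀ l : List (D.Half × Label),
    D.Enumerates s (D.first c :: D.second c :: l.map Prod.fst) →
    φ (D.wedge R s ((D.first c, .one) :: (D.second c, .one) :: l)) =
      D.wedge R t ((D.first c, .one) :: l)
  X_one : ∀ l : List (D.Half × Label),
    D.Enumerates s (D.first c :: D.second c :: l.map Prod.fst) →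
    φ (D.wedge R s ((D.first c, .X) :: (D.second c, .one) :: l)) =
      D.wedge R t ((D.first c, .X) :: l)
  one_X : ∀ l : List (D.Half × Label),
    D.Enumerates s (D.first c :: D.second c :: l.map Prod.fst) →
    φ (D.wedge R s ((D.first c, .one) :: (D.second c, .X) :: l)) =
      D.wedge R t ((D.first c, .X) :: l)
  X_X : ∀ l : List (D.Half × Label),
    D.Enumerates s (D.first c :: D.second c :: l.map Prod.fst) →
    φ (D.wedge R s ((D.first c, .X) :: (D.second c, .X) :: l)) = 0

/-- `φ` is the comultiplication `Δ` at the crossing `c`, applied to the circle at `c`, taken in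
the first position with its local orientation; all other circles are unchanged. -/
structure IsComultiplication (R : Type*) [Ring R] (D : VirtualDiagram) (c : Fin D.classical)
    (s t : D.State) (φ : D.StateSpace R s →ₗ[R] D.StateSpace R t) : Prop where
  one : ∀ l : List (D.Half × Label),
    D.Enumerates s (D.first c :: l.map Prod.fst) →
    φ (D.wedge R s ((D.first c, .one) :: l)) =
      D.wedge R t ((D.first c, .one) :: (D.second c, .X) :: l) +
        D.wedge R t ((D.first c, .X) :: (D.second c, .one) :: l)
  X : ∀ l : List (D.Half × Label),
    D.Enumerates s (D.first c :: l.map Prod.fst) →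
    φ (D.wedge R s ((D.first c, .X) :: l)) =
      D.wedge R t ((D.first c, .X) :: (D.second c, .X) :: l)

/-- `φ` is the partial differential on the edge `s → t` at the crossing `c`: the map `m` for a
`2 → 1` bifurcation, the map `Δ` for a `1 → 2` bifurcation, zero for a `1 → 1` bifurcation. -/
structure IsPartialDifferential (R : Type*) [Ring R] (D : VirtualDiagram) (c : Fin D.classical)
    (s t : D.State) (φ : D.StateSpace R s →ₗ[R] D.StateSpace R t) : Prop where
  two_one : ¬ D.OneCircleAt c s → D.OneCircleAt c t → D.IsMultiplication R c s t φ
  one_two : D.OneCircleAt c s → ¬ D.OneCircleAt c t → D.IsComultiplication R c s t φ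
  one_one : D.OneCircleAt c s → D.OneCircleAt c t → φ = 0

/-- The family `d` consists of the partial differentials on the edges of the cube, and of zero maps
between the other pairs of states. -/
structure IsCubeDifferential (R : Type*) [Ring R] (D : VirtualDiagram)
    (d : ∀ s t : D.State, D.StateSpace R s →ₗ[R] D.StateSpace R t) : Prop where
  on_edge : ∀ c s t, D.CubeEdge c s t → D.IsPartialDifferential R c s t (d s t)
  off_edge : ∀ s t, (¬ ∃ c, D.CubeEdge c s t) → d s t = 0

/-- The chain space `[[D]]`: the direct sum of the spaces of all states. -/
abbrev Chains (R : Type*) [Ring R] (D : VirtualDiagram) : Type _ :=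
  ⨁ s : D.State, D.StateSpace R s

/-- The inclusion of the space of a state as a summand. -/
noncomputable def inclusion (R : Type*) [Ring R] (D : VirtualDiagram) (s : D.State) :
    D.StateSpace R s →ₗ[R] D.Chains R :=
  DirectSum.lof R D.State (fun s => D.StateSpace R s) s

/-- The differential `∂` of `[[D]]`: the sum of the partial differentials. -/
noncomputable def boundary (R : Type*) [Ring R] (D : VirtualDiagram)
    (d : ∀ s t : D.State, D.StateSpace R s →ₗ[R] D.StateSpace R t) :
    D.Chains R →ₗ[R] D.Chains R :=
  DirectSum.toModule R D.State (D.Chains R) fun s => ∑ t : D.State, (D.inclusion R t) ∘ₗ (d s t)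

/-- The height of a state: the number of its `B`-smoothings. -/
def height (D : VirtualDiagram) (s : D.State) : ℕ :=
  (Finset.univ.filter fun c => s c = .B).card

/-- The grading of a monomial: the number of factors `1` minus the number of factors `X` plus the
height of the state. -/
def grading (D : VirtualDiagram) (s : D.State) (l : List (D.Half × Label)) : ℤ :=
  (l.map Prod.snd).count .one - (l.map Prod.snd).count .X + D.height s

/-- The bigraded piece of height `i` and grading `j` of `[[D]]`. -/
noncomputable def bigradedPiece (R : Type*) [Ring R] (D : VirtualDiagram) (i : ℕ) (j : ℤ) :
    Submodule R (D.Chains R) :=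
  Submodule.span R {y | ∃ (s : D.State) (l : List (D.Half × Label)),
    D.Enumerates s (l.map Prod.fst) ∧ D.height s = i ∧ D.grading s l = j ∧
    y = D.inclusion R s (D.wedge R s l)}

end VirtualDiagram

/-!
The half-edges of the diagram carry two fixed point free involutions, the edges of the diagram and
the arcs of a state. Their product `stepPerm` is a permutation whose cycles are the oriented circles
of the state. An edge of the cube is a surgery (`Surgery`): with `p` and `q` the two half-edges of
the crossing that point towards it in the local orientation, `stepPerm` is multiplied by the
transposition of `p` and `q` and by the one of their partners. The behaviour of cycles under
multiplication by a transposition gives the trichotomy: different circles merge coherently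
(`Surgery.sameOriented_iff_of_merge`); a circle through `p` and `q` with equal orientations splits
(`Surgery.not_sameCircle_of_split`); a circle through `p` and `q` with opposite orientations stays
one circle (`Surgery.sameOriented_edge_of_single`).

The defining relations of the space of a state bring every monomial to a given order and
orientation of the circles, so the `2 ^ k` products generate. They are independent because the
signs of the relations are consistent: the sign of the permutation of the circles times the
orientation signs of the factors `X` turns a monomial into a well defined unit vector
(`coordinates`). Homogeneity of the basis gives the bigrading.

The partial differentials commute with the multiplications `xMul` by `X` on the circle through any
half-edge. As the space of a state is generated by `1 ∧ ⋯ ∧ 1` under these multiplications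
(`linearMap_ext_ones`), a partial differential is determined by the image of `1 ∧ ⋯ ∧ 1`, which is
`1 ∧ ⋯ ∧ 1` for a merging, `(X₁ + X₂) (1 ∧ ⋯ ∧ 1)` for a splitting, and `0` otherwise
(`IsSurgeryMap`); and a face of the cube has to be checked on this one element only.

Interchanging the two arcs at a crossing changes the sign of its partial differential, reversing
the local orientation does not change it (`IsSurgeryMap.swap`, `IsSurgeryMap.reverse`). Hence
anticommutativity may be checked up to these changes at both crossings, and there remain a few
configurations of a face (`FaceAnticommutes`). In most of them the sign comes from reordering the
circles. Two are subtler. If the same two circles meet at both crossings, the circles after both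
surgeries are paired crosswise with the ends of the two chords (`Surgery.crossed_of_double_merge`),
and this interchange produces the sign; the same fact, read backwards, settles two interleaved
chords on one circle. If one of the crossings gives a `1 → 1` bifurcation, both composites vanish,
the second one possibly because a splitting followed by an incoherent merging gives `X - X = 0`
(`FaceAnticommutes.single`).
-/

/-! ### Cycles of permutations -/

namespace Equiv.Perm

variable {α : Type*} {f g : Equiv.Perm α} {x y x₀ : α}

lemma pow_succ_apply_of_agree {n : ℕ} (h₀ : g x₀ = f x)
    (h : ∀ k < n, g ((f ^ (k + 1)) x) = f ((f ^ (k + 1)) x)) :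
    (g ^ (n + 1)) x₀ = (f ^ (n + 1)) x := by
  induction n with
  | zero => simpa using h₀
  | succ n ih =>
    rw [pow_succ', mul_apply, ih fun k hk => h k (by omega), h n (by omega), pow_succ' f (n + 1),
      mul_apply]

variable [Finite α]

/-- The path along a cycle from `x` to the first occurrence of `y` after `x` meets neither
`x` nor `y` in between. -/
lemma SameCycle.exists_first_hit (h : SameCycle f x y) :
    ∃ n : ℕ, (f ^ (n + 1)) x = y ∧ ∀ k < n, (f ^ (k + 1)) x ≠ x ∧ (f ^ (k + 1)) x ≠ y := by
  classical
  have hex : ∃ n : ℕ, (f ^ (n + 1)) x = y := by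
    obtain ⟨i, hi, -, h⟩ := h.exists_pow_eq''
    exact ⟨i - 1, by rwa [Nat.sub_add_cancel hi]⟩
  refine ⟨Nat.find hex, Nat.find_spec hex, fun k hk => ⟨fun hx => ?_, Nat.find_min hex hk⟩⟩
  obtain ⟨m, hm⟩ : ∃ m, Nat.find hex = k + 1 + m := ⟨_, (Nat.add_sub_cancel' hk).symm⟩
  have h1 := Nat.find_spec hex
  have h2 : (f ^ (m + 1)) x = y := by
    rw [hm, show k + 1 + m + 1 = (m + 1) + (k + 1) by ring, pow_add, mul_apply, hx] at h1
    exact h1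
  exact Nat.find_min hex (by omega) h2

/-- If `g` sends `x₀` to where `f` sends `x` and agrees with `f` on the rest of the path along the
cycle of `f` from `x` to `y`, then `g` leads from `x₀` to `y`. -/
lemma SameCycle.reroute (h : SameCycle f x y) (h₀ : g x₀ = f x)
    (hfg : ∀ z, SameCycle f x z → z ≠ x → z ≠ y → g z = f z) : SameCycle g x₀ y := by
  obtain ⟨n, hn, hk⟩ := h.exists_first_hit
  refine ⟨(n + 1 : ℕ), ?_⟩
  rw [zpow_natCast, pow_succ_apply_of_agree h₀, hn]
  exact fun k hkn => hfg _ (sameCycle_pow_right.2 (SameCycle.refl f x)) (hk k hkn).1 (hk k hkn).2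

lemma SameCycle.rel_of_forall {r : α → α → Prop} (hr : Equivalence r) (h : ∀ x, r x (f x))
    (hxy : SameCycle f x y) : r x y := by
  obtain ⟨n, -, -, rfl⟩ := hxy.exists_pow_eq''
  induction n with
  | zero => exact hr.refl _
  | succ n ih =>
    rw [pow_succ', mul_apply]
    exact hr.trans (ih (sameCycle_pow_right.2 (SameCycle.refl f x))) (h _)

variable [DecidableEq α] {p q : α}

/-- Composition with a transposition of points on two cycles merges these two cycles. -/
lemma sameCycle_mul_swap_of_not (hpq : ¬ SameCycle f p q) :
    SameCycle (f * swap p q) x y ↔ SameCycle f x y ∨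
      ((SameCycle f x p ∨ SameCycle f x q) ∧ (SameCycle f y p ∨ SameCycle f y q)) := by
  have key : SameCycle (f * swap p q) p q := by
    refine (SameCycle.refl f q).reroute (by simp) fun z hz hzq _ => ?_
    rw [mul_apply, swap_apply_of_ne_of_ne _ hzq]
    rintro rfl
    exact hpq hz.symm
  have hle : ∀ {x y}, SameCycle f x y → SameCycle (f * swap p q) x y := by
    intro x y hxy
    refine hxy.rel_of_forall (SameCycle.equivalence _) fun x => ?_
    rcases eq_or_ne x p with rfl | hp
    · exact key.trans ⟨1, by simp⟩
    rcases eq_or_ne x q with rfl | hq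
    · exact key.symm.trans ⟨1, by simp⟩
    · exact ⟨1, by simp [swap_apply_of_ne_of_ne hp hq]⟩
  constructor
  · intro hxy
    refine hxy.rel_of_forall (r := fun x y => SameCycle f x y ∨
      ((SameCycle f x p ∨ SameCycle f x q) ∧ (SameCycle f y p ∨ SameCycle f y q)))
      ⟨?_, ?_, ?_⟩ fun x => ?_
    · exact fun x => Or.inl (SameCycle.refl f x)
    · rintro x y (h | h)
      exacts [Or.inl h.symm, Or.inr h.symm]
    · rintro x y z (h | ⟨h, h'⟩) (k | ⟨k, k'⟩)
      · exact Or.inl (h.trans k)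
      · exact Or.inr ⟨k.imp h.trans h.trans, k'⟩
      · exact Or.inr ⟨h, h'.imp k.symm.trans k.symm.trans⟩
      · exact Or.inr ⟨h, k'⟩
    · rcases eq_or_ne x p with rfl | hp
      · exact Or.inr ⟨Or.inl (SameCycle.refl f _), Or.inr ⟨-1, by simp⟩⟩
      rcases eq_or_ne x q with rfl | hq
      · exact Or.inr ⟨Or.inr (SameCycle.refl f _), Or.inl ⟨-1, by simp⟩⟩
      · exact Or.inl ⟨1, by simp [swap_apply_of_ne_of_ne hp hq]⟩
  · have hm : ∀ {x}, SameCycle f x p ∨ SameCycle f x q → SameCycle (f * swap p q) x p := by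
      rintro x (h | h)
      exacts [hle h, (hle h).trans key.symm]
    rintro (h | ⟨h, h'⟩)
    exacts [hle h, (hm h).trans (hm h').symm]

/-- Composition with a transposition of two points on one cycle splits this cycle. -/
lemma SameCycle.not_sameCycle_mul_swap (h : SameCycle f p q) (hpq : p ≠ q) :
    ¬ SameCycle (f * swap p q) p q := by
  intro hg
  obtain ⟨n, hn, hk⟩ := h.exists_first_hit
  obtain ⟨m, hm, hk'⟩ := hg.symm.exists_first_hit
  have agree : ∀ j ≤ n, ((f * swap p q) ^ (j + 1)) q = (f ^ (j + 1)) p := fun j hj =>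
    pow_succ_apply_of_agree (by simp) fun k hkj => by
      rw [mul_apply, swap_apply_of_ne_of_ne (hk k (by omega)).1 (hk k (by omega)).2]
  rcases lt_trichotomy m n with hmn | rfl | hmn
  · exact (hk m hmn).1 (by rw [← agree m hmn.le, hm])
  · exact hpq (by rw [← hm, agree m le_rfl, hn])
  · exact (hk' n hmn).1 (by rw [agree n le_rfl, hn])

end Equiv.Perm

namespace VirtualDiagram

variable (D : VirtualDiagram) {s t u t' : D.State} {x y z p q a a' b b' : D.Half}

/-! ### The circles of a state as cycles of a permutation -/

instance : Finite D.Half :=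
  Finite.of_injective
    (β := (D.Crossing × Side) ⊕ (D.Crossing × Side) ⊕ (Fin D.loops × Bool))
    (fun h => match h with
      | .upper x i => .inl (x, i)
      | .lower x i => .inr (.inl (x, i))
      | .loop k b => .inr (.inr (k, b)))
    (by rintro (_ | _ | _) (_ | _ | _) h <;> simp_all)

lemma edge_edge (h : D.Half) : D.edge (D.edge h) = h := by
  cases h <;> simp [edge]

lemma edge_ne (h : D.Half) : D.edge h ≠ h := by
  cases h <;> simp [edge]

lemma arc_arc (s : D.State) (h : D.Half) : D.arc s (D.arc s h) = h := by
  have hf : ∀ i : Side, i.flip.flip = i := by rintro (_ | _) <;> rfl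
  rcases h with ⟨c | v, i⟩ | ⟨c | v, i⟩ | ⟨k, b⟩
  · by_cases h : IsLeftRight (D.sign c) (s c) <;> simp [arc, h, hf]
  · simp [arc, hf]
  · by_cases h : IsLeftRight (D.sign c) (s c) <;> simp [arc, h, hf]
  · simp [arc, hf]
  · simp [arc]

lemma arc_ne (s : D.State) (h : D.Half) : D.arc s h ≠ h := by
  have hf : ∀ i : Side, i.flip ≠ i := by rintro (_ | _) <;> simp [Side.flip]
  rcases h with ⟨c | v, i⟩ | ⟨c | v, i⟩ | ⟨k, b⟩ <;> simp only [arc] <;>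
    (try split_ifs) <;> simp [hf]

/-- The walk along the circles of a state as a permutation of the half-edges. -/
def stepPerm (s : D.State) : Equiv.Perm D.Half where
  toFun := D.step s
  invFun h := D.arc s (D.edge h)
  left_inv h := by simp [step, edge_edge, arc_arc]
  right_inv h := by simp [step, edge_edge, arc_arc]

lemma stepPerm_apply (s : D.State) (h : D.Half) : D.stepPerm s h = D.edge (D.arc s h) := rfl

variable {D}

lemma sameOriented_iff : D.SameOriented s x y ↔ (D.stepPerm s).SameCycle x y := by
  have h (n : ℕ) : (D.step s)^[n] x = (D.stepPerm s ^ n) x := by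
    rw [Equiv.Perm.coe_pow]; rfl
  constructor
  · rintro ⟨n, hn⟩
    exact ⟨n, by rw [zpow_natCast, ← h, hn]⟩
  · intro hxy
    obtain ⟨n, -, -, hn⟩ := hxy.exists_pow_eq''
    exact ⟨n, by rw [h, hn]⟩

lemma SameOriented.refl (s : D.State) (x : D.Half) : D.SameOriented s x x := ⟨0, rfl⟩

lemma SameOriented.symm (h : D.SameOriented s x y) : D.SameOriented s y x :=
  sameOriented_iff.2 (sameOriented_iff.1 h).symm

lemma SameOriented.trans (h : D.SameOriented s x y) (h' : D.SameOriented s y z) :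
    D.SameOriented s x z :=
  sameOriented_iff.2 ((sameOriented_iff.1 h).trans (sameOriented_iff.1 h'))

lemma sameOriented_comm : D.SameOriented s x y ↔ D.SameOriented s y x := ⟨.symm, .symm⟩

lemma SameOriented.edge (h : D.SameOriented s x y) : D.SameOriented s (D.edge x) (D.edge y) := by
  rw [sameOriented_iff] at h
  refine h.rel_of_forall (r := fun x y => D.SameOriented s (D.edge x) (D.edge y))
    ⟨fun _ => .refl _ _, .symm, .trans⟩ fun x => SameOriented.symm ⟨1, ?_⟩
  simp [stepPerm_apply, step, edge_edge, arc_arc]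

lemma sameOriented_edge_edge :
    D.SameOriented s (D.edge x) (D.edge y) ↔ D.SameOriented s x y :=
  ⟨fun h => by simpa [edge_edge] using h.edge, .edge⟩

lemma sameOriented_edge_left :
    D.SameOriented s (D.edge x) y ↔ D.SameOriented s x (D.edge y) := by
  rw [← sameOriented_edge_edge, edge_edge]

lemma sameOriented_edge_arc : D.SameOriented s (D.edge x) (D.arc s x) :=
  SameOriented.symm ⟨1, by simp [step, arc_arc]⟩

lemma oppositelyOriented_iff :
    D.OppositelyOriented s x y ↔ D.SameOriented s x (D.edge y) := by
  rw [← sameOriented_edge_left]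
  exact ⟨sameOriented_edge_arc.trans, sameOriented_edge_arc.symm.trans⟩

/-- A circle does not coincide with itself with the opposite orientation: otherwise one of the
reflections of the dihedral group generated by `edge` and `arc` would have a fixed point, although
they are all conjugate to one of these two involutions. -/
lemma not_sameOriented_edge (s : D.State) (x : D.Half) : ¬ D.SameOriented s x (D.edge x) := by
  rintro ⟨n, hn⟩
  induction n using Nat.strong_induction_on generalizing x with
  | _ n ih =>
    match n, hn with
    | 0, hn => exact D.edge_ne x hn.symm
    | 1, hn =>
      refine D.arc_ne s x ?_
      have : D.edge (D.edge (D.arc s x)) = D.edge (D.edge x) := congrArg D.edge hn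
      simpa only [edge_edge] using this
    | n + 2, hn =>
      refine ih n (by omega) (D.step s x) ((D.stepPerm s).injective ?_)
      change D.step s _ = D.step s _
      rw [← Function.iterate_succ_apply' (D.step s), ← Function.iterate_succ_apply, hn]
      simp [step, edge_edge, arc_arc]

lemma not_edge_of_sameOriented (h : D.SameOriented s x y) : ¬ D.SameOriented s x (D.edge y) :=
  fun h' => not_sameOriented_edge s y (h.symm.trans h')

lemma sameCircle_iff :
    D.SameCircle s x y ↔ D.SameOriented s x y ∨ D.SameOriented s x (D.edge y) := by
  rw [SameCircle, oppositelyOriented_iff]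

lemma SameOriented.sameCircle (h : D.SameOriented s x y) : D.SameCircle s x y := Or.inl h

lemma SameCircle.refl (s : D.State) (x : D.Half) : D.SameCircle s x x := Or.inl (.refl s x)

lemma SameCircle.symm (h : D.SameCircle s x y) : D.SameCircle s y x := by
  rw [sameCircle_iff] at h ⊢
  exact h.imp .symm fun h => (sameOriented_edge_left.2 h).symm

lemma SameCircle.trans (h : D.SameCircle s x y) (h' : D.SameCircle s y z) :
    D.SameCircle s x z := by
  rw [sameCircle_iff] at h h' ⊢
  rcases h with h | h <;> rcases h' with h' | h'
  · exact .inl (h.trans h')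
  · exact .inr (h.trans h')
  · exact .inr (h.trans h'.edge)
  · exact .inl (h.trans (by simpa [edge_edge] using h'.edge))

lemma sameCircle_comm : D.SameCircle s x y ↔ D.SameCircle s y x := ⟨.symm, .symm⟩

lemma sameOriented_arc_arc :
    D.SameOriented s (D.arc s x) (D.arc s y) ↔ D.SameOriented s x y := by
  rw [← sameOriented_edge_edge (x := x)]
  exact ⟨fun h => (sameOriented_edge_arc.trans h).trans sameOriented_edge_arc.symm,
    fun h => (sameOriented_edge_arc.symm.trans h).trans sameOriented_edge_arc⟩

lemma sameCircle_arc (s : D.State) (x : D.Half) : D.SameCircle s x (D.arc s x) :=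
  sameCircle_iff.2 (.inr (by
    rw [← sameOriented_edge_left]; exact sameOriented_edge_arc))

/-! ### Surgeries -/

/-- `t` arises from `s` by replacing the arcs through the half-edges `p` and `q`, which both point
towards the crossing, by the two other arcs that join an incoming to an outgoing end. -/
structure Surgery (D : VirtualDiagram) (s t : D.State) (p q : D.Half) : Prop where
  arc_p : D.arc t p = D.arc s q
  arc_q : D.arc t q = D.arc s p
  arc_arc_p : D.arc t (D.arc s p) = q
  arc_arc_q : D.arc t (D.arc s q) = p
  arc_of_ne : ∀ h, h ≠ p → h ≠ q → h ≠ D.arc s p → h ≠ D.arc s q → D.arc t h = D.arc s h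
  ne : p ≠ q
  ne_arc : p ≠ D.arc s q

namespace Surgery

lemma arc_ne_right (S : D.Surgery s t p q) : D.arc s p ≠ q := fun h =>
  S.ne_arc (by rw [← h, arc_arc])

lemma swap (S : D.Surgery s t p q) : D.Surgery s t q p where
  arc_p := S.arc_q
  arc_q := S.arc_p
  arc_arc_p := S.arc_arc_q
  arc_arc_q := S.arc_arc_p
  arc_of_ne h h₁ h₂ h₃ h₄ := S.arc_of_ne h h₂ h₁ h₄ h₃
  ne := S.ne.symm
  ne_arc := S.arc_ne_right.symm

lemma reverse (S : D.Surgery s t p q) : D.Surgery s t (D.arc s p) (D.arc s q) where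
  arc_p := by rw [arc_arc]; exact S.arc_arc_p
  arc_q := by rw [arc_arc]; exact S.arc_arc_q
  arc_arc_p := by rw [arc_arc]; exact S.arc_p
  arc_arc_q := by rw [arc_arc]; exact S.arc_q
  arc_of_ne h h₁ h₂ h₃ h₄ := by
    rw [arc_arc] at h₃ h₄
    exact S.arc_of_ne h h₃ h₄ h₁ h₂
  ne h := S.ne (by rw [← D.arc_arc s p, h, arc_arc])
  ne_arc := by rw [arc_arc]; exact S.arc_ne_right

lemma inv (S : D.Surgery s t p q) : D.Surgery t s p q where
  arc_p := by rw [S.arc_q]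
  arc_q := by rw [S.arc_p]
  arc_arc_p := by rw [S.arc_p, arc_arc]
  arc_arc_q := by rw [S.arc_q, arc_arc]
  arc_of_ne h h₁ h₂ h₃ h₄ := by
    rw [S.arc_p] at h₃
    rw [S.arc_q] at h₄
    exact (S.arc_of_ne h h₁ h₂ h₄ h₃).symm
  ne := S.ne
  ne_arc := by rw [S.arc_q]; exact (D.arc_ne s p).symm

lemma stepPerm_eq (S : D.Surgery s t p q) :
    D.stepPerm t = D.stepPerm s * Equiv.swap p q * Equiv.swap (D.arc s p) (D.arc s q) := by
  classical
  ext h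
  simp only [stepPerm_apply, Equiv.Perm.mul_apply]
  congr 1
  have e1 := S.ne
  have e2 := S.ne_arc
  have e3 := S.arc_ne_right
  have e4 : D.arc s p ≠ D.arc s q := S.reverse.ne
  have e5 := D.arc_ne s p
  have e6 := D.arc_ne s q
  rcases eq_or_ne h p with rfl | h1
  · rw [Equiv.swap_apply_of_ne_of_ne e5.symm e2, Equiv.swap_apply_left, S.arc_p]
  rcases eq_or_ne h q with rfl | h2
  · rw [Equiv.swap_apply_of_ne_of_ne e3.symm e6.symm, Equiv.swap_apply_right, S.arc_q]
  rcases eq_or_ne h (D.arc s p) with rfl | h3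
  · rw [Equiv.swap_apply_left, Equiv.swap_apply_of_ne_of_ne e2.symm e6, S.arc_arc_p, arc_arc]
  rcases eq_or_ne h (D.arc s q) with rfl | h4
  · rw [Equiv.swap_apply_right, Equiv.swap_apply_of_ne_of_ne e5 e3, S.arc_arc_q, arc_arc]
  rw [Equiv.swap_apply_of_ne_of_ne h3 h4, Equiv.swap_apply_of_ne_of_ne h1 h2,
    S.arc_of_ne h h1 h2 h3 h4]

end Surgery
end VirtualDiagram

/-! ### The effect of a surgery on the circles -/

namespace VirtualDiagram

variable {D : VirtualDiagram} {s t u t' : D.State} {x y z p q a a' b b' : D.Half}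

lemma sameOriented_arc_right :
    D.SameOriented s x (D.arc s y) ↔ D.SameOriented s x (D.edge y) :=
  ⟨fun h => h.trans sameOriented_edge_arc.symm, fun h => h.trans sameOriented_edge_arc⟩

lemma sameOriented_arc_left :
    D.SameOriented s (D.arc s x) y ↔ D.SameOriented s x (D.edge y) := by
  rw [sameOriented_comm, sameOriented_arc_right, sameOriented_comm, sameOriented_edge_left]

namespace Surgery

/-- A surgery between two different circles merges them, compatibly with the orientations at the
crossing, and changes nothing else. -/
lemma sameOriented_iff_of_merge (S : D.Surgery s t p q) (h : ¬ D.SameCircle s p q) :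
    D.SameOriented t x y ↔ D.SameOriented s x y ∨
      ((D.SameOriented s x p ∨ D.SameOriented s x q) ∧
        (D.SameOriented s y p ∨ D.SameOriented s y q)) ∨
      ((D.SameOriented s x (D.edge p) ∨ D.SameOriented s x (D.edge q)) ∧
        (D.SameOriented s y (D.edge p) ∨ D.SameOriented s y (D.edge q))) := by
  rw [sameCircle_iff, not_or] at h
  have h₀ : ∀ {x y : D.Half}, (D.stepPerm s * Equiv.swap p q).SameCycle x y ↔ _ :=
    Equiv.Perm.sameCycle_mul_swap_of_not (mt sameOriented_iff.2 h.1)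
  simp only [← sameOriented_iff] at h₀
  have hp : ¬ (D.SameOriented s (D.arc s p) p ∨ D.SameOriented s (D.arc s p) q) := by
    simp only [sameOriented_arc_left]
    exact fun h' => h'.elim (not_sameOriented_edge s p) h.2
  have hq : ¬ (D.SameOriented s (D.arc s q) p ∨ D.SameOriented s (D.arc s q) q) := by
    simp only [sameOriented_arc_left]
    exact fun h' => h'.elim (fun h' => h.2 (sameOriented_edge_left.1 h'.symm))
      (not_sameOriented_edge s q)
  have hpq : ¬ (D.stepPerm s * Equiv.swap p q).SameCycle (D.arc s p) (D.arc s q) := by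
    rw [h₀, sameOriented_arc_arc]
    tauto
  rw [sameOriented_iff (s := t), S.stepPerm_eq, Equiv.Perm.sameCycle_mul_swap_of_not hpq]
  have hx : ∀ {x}, (D.stepPerm s * Equiv.swap p q).SameCycle x (D.arc s p) ↔
      D.SameOriented s x (D.edge p) := by
    intro x
    rw [h₀, ← sameOriented_arc_right]
    tauto
  have hy : ∀ {x}, (D.stepPerm s * Equiv.swap p q).SameCycle x (D.arc s q) ↔
      D.SameOriented s x (D.edge q) := by
    intro x
    rw [h₀, ← sameOriented_arc_right]
    tauto
  rw [hx, hx, hy, hy, h₀]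
  tauto

lemma le_of_merge (S : D.Surgery s t p q) (h : ¬ D.SameCircle s p q)
    (hxy : D.SameOriented s x y) : D.SameOriented t x y :=
  (S.sameOriented_iff_of_merge h).2 (.inl hxy)

lemma sameOriented_of_merge (S : D.Surgery s t p q) (h : ¬ D.SameCircle s p q) :
    D.SameOriented t p q :=
  (S.sameOriented_iff_of_merge h).2 (.inr (.inl ⟨.inl (.refl s p), .inr (.refl s q)⟩))

lemma sameCircle_iff_of_merge (S : D.Surgery s t p q) (h : ¬ D.SameCircle s p q) :
    D.SameCircle t x y ↔ D.SameCircle s x y ∨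
      ((D.SameCircle s x p ∨ D.SameCircle s x q) ∧
        (D.SameCircle s y p ∨ D.SameCircle s y q)) := by
  simp only [sameCircle_iff, S.sameOriented_iff_of_merge h,
    sameOriented_edge_left (x := y), edge_edge]
  tauto

lemma circle_le_of_merge (S : D.Surgery s t p q) (h : ¬ D.SameCircle s p q)
    (hxy : D.SameCircle s x y) : D.SameCircle t x y :=
  (S.sameCircle_iff_of_merge h).2 (.inl hxy)

/-- A surgery on a circle that passes twice through the crossing with coherent orientations splits
this circle. -/
lemma not_sameCircle_of_split (S : D.Surgery s t p q) (h : D.SameOriented s p q) :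
    ¬ D.SameCircle t p q := by
  have hq : ¬ D.SameOriented s p (D.edge q) := not_edge_of_sameOriented h
  have h₁ : ¬ (D.stepPerm s * Equiv.swap p q).SameCycle p q :=
    (sameOriented_iff.1 h).not_sameCycle_mul_swap S.ne
  have e₁ : D.stepPerm s = D.stepPerm s * Equiv.swap p q * Equiv.swap p q := by simp [mul_assoc]
  have m₁ : ∀ {x y : D.Half}, D.SameOriented s x y ↔ _ := fun {x y} => by
    rw [sameOriented_iff, e₁, Equiv.Perm.sameCycle_mul_swap_of_not h₁]
  have h₂ : (D.stepPerm s * Equiv.swap p q).SameCycle (D.arc s p) (D.arc s q) := by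
    have hle : ∀ {x y}, (D.stepPerm s * Equiv.swap p q).SameCycle x y → D.SameOriented s x y :=
      fun hxy => m₁.2 (.inl hxy)
    refine (m₁.1 (sameOriented_arc_arc.2 h)).resolve_right fun h' => ?_
    rcases h'.1 with h' | h'
    · exact not_sameOriented_edge s p (sameOriented_arc_left.1 (hle h'))
    · exact hq (sameOriented_arc_left.1 (hle h'))
  have h₃ := h₂.not_sameCycle_mul_swap S.reverse.ne
  rw [← S.stepPerm_eq, ← sameOriented_iff] at h₃
  rw [sameCircle_iff, not_or]
  constructor
  · intro h'
    rw [← sameOriented_arc_arc, S.arc_p, S.arc_q] at h'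
    exact h₃ h'.symm
  · intro h'
    have e₂ : D.stepPerm s * Equiv.swap p q =
        D.stepPerm t * Equiv.swap (D.arc s p) (D.arc s q) := by
      simp [S.stepPerm_eq, mul_assoc]
    refine hq (m₁.2 (.inl ?_))
    rw [e₂, Equiv.Perm.sameCycle_mul_swap_of_not (mt sameOriented_iff.2 h₃), ← sameOriented_iff]
    exact .inl h'

/-- A surgery on a circle that passes twice through the crossing with incoherent orientations is a
`1 → 1` bifurcation. -/
lemma sameOriented_edge_of_single (S : D.Surgery s t p q) (h : D.SameOriented s p (D.edge q)) :
    D.SameOriented t p (D.edge q) := by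
  by_contra h'
  by_cases h'' : D.SameCircle t p q
  · rw [sameCircle_iff] at h''
    exact S.inv.not_sameCircle_of_split (h''.resolve_right h') (sameCircle_iff.2 (.inr h))
  · exact not_edge_of_sameOriented (S.inv.sameOriented_of_merge h'') h

/-- After two surgeries at which the same two circles meet coherently, the ends of the two chords
are paired crosswise: the walk of `s` from `b'` to `a'` is followed by the walk of `u` from `b`. -/
lemma crossed_of_double_merge (Sa : D.Surgery s t a a') (Sb : D.Surgery t u b b')
    (hb : ∀ x, x = b ∨ x = b' → D.arc t x = D.arc s x)
    (ha : ¬ D.SameCircle s a a') (hab : D.SameOriented s a b) (hab' : D.SameOriented s a' b') :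
    D.SameOriented u b a' := by
  rw [sameCircle_iff, not_or] at ha
  rw [sameOriented_iff]
  refine (sameOriented_iff.1 hab'.symm).reroute ?_ fun z hz hzb hza => ?_
  · rw [stepPerm_apply, stepPerm_apply, Sb.arc_p, hb b' (.inr rfl)]
  · rw [← sameOriented_iff] at hz
    replace hz := hab'.trans hz
    have n₁ : ¬ D.SameOriented s a' a := fun h => ha.1 h.symm
    have n₂ : ¬ D.SameOriented s a' (D.edge a) := fun h => ha.2 (sameOriented_edge_left.1 h.symm)
    have n₃ := not_sameOriented_edge s a'
    have e : D.arc t z = D.arc s z := Sa.arc_of_ne z (by rintro rfl; exact n₁ hz) hza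
      (by rintro rfl; exact n₂ (sameOriented_arc_right.1 hz))
      (by rintro rfl; exact n₃ (sameOriented_arc_right.1 hz))
    rw [stepPerm_apply, stepPerm_apply, ← e, Sb.arc_of_ne z _ hzb]
    · rw [hb b (.inl rfl)]
      rintro rfl
      exact n₂ ((sameOriented_arc_right.1 hz).trans hab.symm.edge)
    · rw [hb b' (.inr rfl)]
      rintro rfl
      exact n₃ ((sameOriented_arc_right.1 hz).trans hab'.symm.edge)
    · rintro rfl
      exact n₁ (hz.trans hab.symm)

end Surgery

end VirtualDiagram

namespace VirtualDiagram

variable {D : VirtualDiagram} {s t u t' : D.State} {x y z p q a a' b b' : D.Half}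

/-! ### Enumerations of the circles -/

/-- Two half-edges are equivalent if they lie on the same circle of the state `s`. -/
def circleSetoid (D : VirtualDiagram) (s : D.State) : Setoid D.Half where
  r := D.SameCircle s
  iseqv := ⟨.refl s, .symm, .trans⟩

/-- The circles of a state, without orientation. -/
def Circle (D : VirtualDiagram) (s : D.State) : Type := Quotient (D.circleSetoid s)

/-- The circle through a half-edge. -/
def circ (D : VirtualDiagram) (s : D.State) (h : D.Half) : D.Circle s :=
  Quotient.mk (D.circleSetoid s) h

lemma circ_eq_iff : D.circ s x = D.circ s y ↔ D.SameCircle s x y :=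
  Quotient.eq (r := D.circleSetoid s)

lemma circ_surjective (s : D.State) : Function.Surjective (D.circ s) := Quotient.mk_surjective

instance : Finite (D.Circle s) := Finite.of_surjective _ (circ_surjective s)

/-- An arbitrary linear order on the circles of a state. -/
noncomputable instance : LinearOrder (D.Circle s) := by
  classical exact linearOrderOfSTO WellOrderingRel

lemma enumerates_iff {l : List D.Half} :
    D.Enumerates s l ↔ (l.map (D.circ s)).Nodup ∧ ∀ c, c ∈ l.map (D.circ s) := by
  rw [List.Nodup, List.pairwise_map, List.pairwise_iff_get]
  constructor
  · intro h
    refine ⟨fun i j hij hc => hij.ne ?_, fun c => ?_⟩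
    · exact (h (l.get j)).unique (circ_eq_iff.1 hc) (SameCircle.refl _ _)
    · obtain ⟨x, rfl⟩ := circ_surjective s c
      obtain ⟨i, hi, -⟩ := h x
      exact List.mem_map.2 ⟨l.get i, l.get_mem i, circ_eq_iff.2 hi⟩
  · rintro ⟨h₁, h₂⟩ x
    obtain ⟨y, hy, hyx⟩ := List.mem_map.1 (h₂ (D.circ s x))
    obtain ⟨i, rfl⟩ := List.get_of_mem hy
    refine ⟨i, circ_eq_iff.1 hyx, fun j hj => ?_⟩
    have hij := (circ_eq_iff.2 hj).trans hyx.symm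
    rcases lt_trichotomy i j with h | h | h
    · exact absurd hij.symm (h₁ i j h)
    · exact h.symm
    · exact absurd hij (h₁ j i h)

lemma Enumerates.perm {l l' : List D.Half} (h : D.Enumerates s l)
    (hl : (l.map (D.circ s)).Perm (l'.map (D.circ s))) : D.Enumerates s l' := by
  rw [enumerates_iff] at h ⊢
  exact ⟨hl.nodup_iff.1 h.1, fun c => hl.mem_iff.1 (h.2 c)⟩

lemma Enumerates.map_perm {l l' : List D.Half} (h : D.Enumerates s l) (h' : D.Enumerates s l') :
    (l.map (D.circ s)).Perm (l'.map (D.circ s)) := by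
  rw [enumerates_iff] at h h'
  exact (List.perm_ext_iff_of_nodup h.1 h'.1).2 fun c => iff_of_true (h.2 c) (h'.2 c)

lemma exists_enumerates_append (w : List D.Half) (hw : (w.map (D.circ s)).Nodup) :
    ∃ e, D.Enumerates s (w ++ e) := by
  classical
  have := Fintype.ofFinite (D.Circle s)
  choose f hf using circ_surjective s
  let F := Finset.univ.filter fun c => c ∉ w.map (D.circ s)
  have hmap : (F.toList.map f).map (D.circ s) = F.toList := by
    rw [List.map_map, show D.circ s ∘ f = id from funext hf, List.map_id]
  refine ⟨F.toList.map f, enumerates_iff.2 ?_⟩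
  rw [List.map_append, hmap]
  refine ⟨hw.append F.nodup_toList fun c hc hc' => ?_, fun c => ?_⟩
  · simp only [F, Finset.mem_toList, Finset.mem_filter] at hc'
    exact hc'.2 hc
  · rw [List.mem_append, Finset.mem_toList, Finset.mem_filter]
    exact (em _).imp_right fun h => ⟨Finset.mem_univ c, h⟩

/-! ### The relations between monomials -/

/-- The circles of a list of labelled half-edges. -/
abbrev circles (D : VirtualDiagram) (s : D.State) (l : List (D.Half × Label)) :
    List (D.Circle s) := (l.map Prod.fst).map (D.circ s)

variable {l l' l'' : List (D.Half × Label)} {ε δ : ℤ} {R : Type*} [Ring R]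

lemma Rel.circles_perm (h : D.Rel s l l' ε) : (D.circles s l).Perm (D.circles s l') := by
  have aux {h h' : D.Half} (hh : D.SameCircle s h h') (p : Label) (l l' : List (D.Half × Label)) :
      (D.circles s (l ++ (h, p) :: l')).Perm (D.circles s (l ++ (h', p) :: l')) := by
    simp [circles, circ_eq_iff.2 hh]
  cases h with
  | swap l a b l' =>
    simp only [circles, List.map_append, List.map_cons]
    exact (List.Perm.swap _ _ _).append_left _
  | same l h h' p l' hh => exact aux hh.sameCircle _ _ _
  | reverse_one l h h' l' hh => exact aux (.inr hh) _ _ _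
  | reverse_X l h h' l' hh => exact aux (.inr hh) _ _ _

lemma Rel.labels_perm (h : D.Rel s l l' ε) : (l.map Prod.snd).Perm (l'.map Prod.snd) := by
  cases h with
  | swap l a b l' =>
    simp only [List.map_append, List.map_cons]
    exact (List.Perm.swap _ _ _).append_left _
  | same | reverse_one | reverse_X => simp

lemma Rel.append_left (h : D.Rel s l l' ε) (w : List (D.Half × Label)) :
    D.Rel s (w ++ l) (w ++ l') ε := by
  cases h with
  | swap l a b l' => simpa using Rel.swap (D := D) (s := s) (w ++ l) a b l'
  | same l h h' p l' hh => simpa using Rel.same (w ++ l) h h' p l' hh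
  | reverse_one l h h' l' hh => simpa using Rel.reverse_one (w ++ l) h h' l' hh
  | reverse_X l h h' l' hh => simpa using Rel.reverse_X (w ++ l) h h' l' hh

lemma wedge_of_enumerates (h : D.Enumerates s (l.map Prod.fst)) :
    D.wedge R s l = (D.relations R s).mkQ (Finsupp.single ⟨l, h⟩ 1) := dif_pos h

lemma wedge_of_not_enumerates (h : ¬ D.Enumerates s (l.map Prod.fst)) :
    D.wedge R s l = 0 := dif_neg h

lemma Rel.wedge_eq (h : D.Rel s l l' ε) : D.wedge R s l = ε • D.wedge R s l' := by
  by_cases hl : D.Enumerates s (l.map Prod.fst)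
  · have hl' := hl.perm h.circles_perm
    rw [wedge_of_enumerates hl, wedge_of_enumerates hl', ← map_zsmul, ← sub_eq_zero, ← map_sub,
      Submodule.mkQ_apply, Submodule.Quotient.mk_eq_zero]
    exact Submodule.subset_span ⟨_, _, ε, h, rfl⟩
  · have hl' : ¬ D.Enumerates s (l'.map Prod.fst) := fun h' => hl (h'.perm h.circles_perm.symm)
    rw [wedge_of_not_enumerates hl, wedge_of_not_enumerates hl', smul_zero]

/-- The reflexive-transitive closure of `Rel`; the signs multiply. -/
inductive RelStar (D : VirtualDiagram) (s : D.State) :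
    List (D.Half × Label) → List (D.Half × Label) → ℤ → Prop
  | refl (l : List (D.Half × Label)) : RelStar D s l l 1
  | head {l l' l'' : List (D.Half × Label)} {ε δ : ℤ} (h : D.Rel s l l' ε)
      (h' : RelStar D s l' l'' δ) : RelStar D s l l'' (ε * δ)

namespace RelStar

lemma single (h : D.Rel s l l' ε) : D.RelStar s l l' ε := by
  simpa using RelStar.head h (.refl l')

lemma trans (h : D.RelStar s l l' ε) (h' : D.RelStar s l' l'' δ) :
    D.RelStar s l l'' (ε * δ) := by
  induction h with
  | refl => simpa using h'
  | head h₁ _ ih => rw [mul_assoc]; exact .head h₁ (ih h')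

lemma append_left (h : D.RelStar s l l' ε) (w : List (D.Half × Label)) :
    D.RelStar s (w ++ l) (w ++ l') ε := by
  induction h with
  | refl => exact .refl _
  | head h₁ _ ih => exact .head (h₁.append_left w) ih

lemma labels_perm (h : D.RelStar s l l' ε) : (l.map Prod.snd).Perm (l'.map Prod.snd) := by
  induction h with
  | refl => exact .refl _
  | head h₁ _ ih => exact h₁.labels_perm.trans ih

lemma wedge_eq (h : D.RelStar s l l' ε) : D.wedge R s l = ε • D.wedge R s l' := by
  induction h with
  | refl => simp
  | head h₁ _ ih => rw [h₁.wedge_eq, ih, mul_smul]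

/-- Moving a factor to the front. -/
lemma move (x : D.Half × Label) (l l' : List (D.Half × Label)) :
    D.RelStar s (l ++ x :: l') (x :: (l ++ l')) ((-1) ^ l.length) := by
  induction l with
  | nil => exact .refl _
  | cons y l ih =>
    rw [List.length_cons, pow_succ]
    exact (ih.append_left [y]).trans (.single (.swap [] y x (l ++ l')))

lemma exists_change (hxy : D.SameCircle s x y) (p : Label) (l : List (D.Half × Label)) :
    ∃ ε, D.RelStar s ((x, p) :: l) ((y, p) :: l) ε := by
  rcases hxy with h | h
  · exact ⟨_, .single (.same [] x y p l h)⟩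
  · cases p
    · exact ⟨_, .single (.reverse_one [] x y l h)⟩
    · exact ⟨_, .single (.reverse_X [] x y l h)⟩

/-- The relations bring every list of labelled circles into a prescribed order and orientation. -/
lemma exists_normalForm (l : List (D.Half × Label)) (e : List D.Half)
    (h : (D.circles s l).Perm (e.map (D.circ s))) :
    ∃ l' ε, l'.map Prod.fst = e ∧ D.RelStar s l l' ε := by
  induction e generalizing l with
  | nil =>
    have : l = [] := by simpa [circles] using h
    exact ⟨l, 1, by simp [this], .refl _⟩
  | cons y e ih =>
    have hy : D.circ s y ∈ D.circles s l := h.mem_iff.2 (by simp)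
    simp only [circles, List.mem_map] at hy
    obtain ⟨_, ⟨⟨x, p⟩, hx, rfl⟩, hxy⟩ := hy
    obtain ⟨l₁, l₂, rfl⟩ := List.append_of_mem hx
    obtain ⟨l', ε, hl', hε⟩ := ih (l₁ ++ l₂) (by
      refine List.Perm.cons_inv (a := D.circ s y) (List.Perm.trans ?_ h)
      simp only [circles, List.map_append, List.map_cons, hxy]
      exact List.perm_middle.symm)
    obtain ⟨δ, hδ⟩ := exists_change (circ_eq_iff.1 hxy) p (l₁ ++ l₂)
    exact ⟨(y, p) :: l', _, by simp [hl'],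
      ((move (x, p) l₁ l₂).trans hδ).trans (hε.append_left [(y, p)])⟩

end RelStar

/-! ### The basis of the space of a state -/

/-- The sign of the permutation that sorts a list without repetitions. -/
def inversionSign {α : Type*} [LinearOrder α] : List α → ℤˣ
  | [] => 1
  | a :: l => (l.map fun b => if b < a then -1 else 1).prod * inversionSign l

lemma inversionSign_swap {α : Type*} [LinearOrder α] {a b : α} (hab : a ≠ b) (l l' : List α) :
    inversionSign (l ++ a :: b :: l') = - inversionSign (l ++ b :: a :: l') := by
  induction l with
  | nil =>
    rcases hab.lt_or_gt with h | h <;>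
      simp [inversionSign, h, h.not_gt, mul_left_comm]
  | cons c l ih =>
    simp only [List.cons_append, inversionSign, ih, mul_neg]
    congr 2
    exact (((List.Perm.swap b a l').append_left l).map _).prod_eq

open Classical in
/-- The orientation of a half-edge relative to an arbitrarily chosen orientation of its circle. -/
noncomputable def orientationSign (D : VirtualDiagram) (s : D.State) (h : D.Half) : ℤˣ :=
  if D.SameOriented s (Quotient.out (D.circ s h)) h then 1 else -1

lemma orientationSign_eq (h : D.SameOriented s x y) :
    D.orientationSign s x = D.orientationSign s y := by
  have hc := circ_eq_iff.2 h.sameCircle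
  unfold orientationSign
  rw [hc]
  congr 1
  exact propext ⟨fun h' => h'.trans h, fun h' => h'.trans h.symm⟩

lemma orientationSign_neg (h : D.SameOriented s x (D.edge y)) :
    D.orientationSign s x = - D.orientationSign s y := by
  have hc := circ_eq_iff.2 (sameCircle_iff.2 (.inr h))
  unfold orientationSign
  rw [hc]
  have h₁ : D.SameCircle s (Quotient.out (D.circ s y)) y :=
    circ_eq_iff.1 (Quotient.out_eq _)
  rw [sameCircle_iff] at h₁
  rcases h₁ with h₁ | h₁
  · rw [if_pos h₁, if_neg fun h' => not_edge_of_sameOriented h₁ (h'.trans h)]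
  · rw [if_neg fun h' => not_edge_of_sameOriented h' h₁, if_pos (h₁.trans h.symm), neg_neg]

/-- The contribution of one factor to the sign of a monomial. -/
noncomputable def factorSign (D : VirtualDiagram) (s : D.State) : D.Half × Label → ℤˣ
  | (_, .one) => 1
  | (h, .X) => D.orientationSign s h

/-- The sign of a monomial relative to chosen orders and orientations of the circles. -/
noncomputable def monomialSign (D : VirtualDiagram) (s : D.State) (l : List (D.Half × Label)) :
    ℤˣ :=
  inversionSign (D.circles s l) * (l.map (D.factorSign s)).prod

/-- The set of circles which carry the label `X` in a monomial. -/
def xCircles (D : VirtualDiagram) (s : D.State) (l : List (D.Half × Label)) : Set (D.Circle s) :=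
  {c | ∃ h, (h, Label.X) ∈ l ∧ D.circ s h = c}

/-- The signs of the relations are consistent. -/
lemma Rel.monomialSign_eq (h : D.Rel s l l' ε) (hl : (D.circles s l).Nodup) :
    (D.monomialSign s l : ℤ) = ε * D.monomialSign s l' := by
  cases h with
  | swap l a b l' =>
    have hab : D.circ s a.1 ≠ D.circ s b.1 := by
      simp only [circles, List.map_append, List.map_cons] at hl
      have := (List.nodup_append.1 hl).2.1
      simp only [List.nodup_cons, List.mem_cons, not_or] at this
      exact this.1.1
    simp only [monomialSign, circles, List.map_append, List.map_cons, inversionSign_swap hab,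
      List.prod_append, List.prod_cons]
    push_cast
    ring
  | same l h h' p l' hh =>
    have : D.factorSign s (h, p) = D.factorSign s (h', p) := by
      cases p
      · rfl
      · exact orientationSign_eq hh
    simp [monomialSign, circles, circ_eq_iff.2 hh.sameCircle, this]
  | reverse_one l h h' l' hh =>
    simp [monomialSign, circles, circ_eq_iff.2 (Or.inr hh), factorSign]
  | reverse_X l h h' l' hh =>
    have := orientationSign_neg (oppositelyOriented_iff.1 hh)
    simp [monomialSign, circles, circ_eq_iff.2 (Or.inr hh), factorSign, this]

lemma Rel.xCircles_eq (h : D.Rel s l l' ε) : D.xCircles s l = D.xCircles s l' := by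
  have aux {h h' : D.Half} (hh : D.SameCircle s h h') (p : Label) (l l' : List (D.Half × Label)) :
      D.xCircles s (l ++ (h, p) :: l') = D.xCircles s (l ++ (h', p) :: l') := by
    ext c
    simp only [xCircles, List.mem_append, List.mem_cons, Prod.mk.injEq, Set.mem_ofPred_eq,
      or_and_right, exists_or, and_assoc, exists_eq_left, circ_eq_iff.2 hh]
  cases h with
  | swap l a b l' =>
    ext c
    simp only [xCircles, List.mem_append, List.mem_cons, Set.mem_ofPred_eq]
    refine exists_congr fun h => and_congr_left' ?_
    tauto
  | same l h h' p l' hh => exact aux hh.sameCircle _ _ _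
  | reverse_one l h h' l' hh => exact aux (.inr hh) _ _ _
  | reverse_X l h h' l' hh => exact aux (.inr hh) _ _ _

/-- The coordinates of an element of the space of a state: the coefficients of the products with
the circles in the chosen order and orientations, indexed by the circles with label `X`. -/
noncomputable def coordinates (R : Type*) [Ring R] (D : VirtualDiagram) (s : D.State) :
    D.StateSpace R s →ₗ[R] (Set (D.Circle s) →₀ R) :=
  (D.relations R s).liftQ
    (Finsupp.linearCombination R fun m : D.Monomial s =>
      (D.monomialSign s m.1 : ℤ) • Finsupp.single (D.xCircles s m.1) (1 : R)) <| by
    rw [relations, Submodule.span_le]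
    rintro _ ⟨a, b, ε, h, rfl⟩
    rw [SetLike.mem_coe, LinearMap.mem_ker, map_sub, map_zsmul, Finsupp.linearCombination_single,
      Finsupp.linearCombination_single, one_smul, one_smul, h.xCircles_eq,
      h.monomialSign_eq (enumerates_iff.1 a.2).1, mul_smul, sub_self]

lemma coordinates_wedge (h : D.Enumerates s (l.map Prod.fst)) :
    D.coordinates R s (D.wedge R s l) =
      (D.monomialSign s l : ℤ) • Finsupp.single (D.xCircles s l) (1 : R) := by
  rw [wedge_of_enumerates h, coordinates, Submodule.mkQ_apply, Submodule.liftQ_apply,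
    Finsupp.linearCombination_single, one_smul]

/-- The monomial with the circles `e` and the labels `p`. -/
def labelled (e : List D.Half) (p : Fin e.length → Label) : List (D.Half × Label) :=
  List.ofFn fun i => (e.get i, p i)

lemma labelled_map_fst (e : List D.Half) (p : Fin e.length → Label) :
    (labelled e p).map Prod.fst = e := by
  rw [labelled, List.map_ofFn]
  exact List.ofFn_get e

lemma exists_labelled (l : List (D.Half × Label)) :
    ∃ p, labelled (l.map Prod.fst) p = l := by
  refine ⟨fun i => (l.get (i.cast (by simp))).2, ?_⟩
  apply List.ext_get
  · simp [labelled]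
  · intro n h₁ h₂
    simp [labelled]

/-- The coordinates of these products are, up to sign, different unit vectors. -/
lemma linearIndependent_wedge {e : List D.Half} (he : D.Enumerates s e) :
    LinearIndependent R fun p : Fin e.length → Label => D.wedge R s (labelled e p) := by
  refine LinearIndependent.of_comp (D.coordinates R s) ?_
  have hinj : Function.Injective fun p : Fin e.length → Label => D.xCircles s (labelled e p) := by
    have key : ∀ (p : Fin e.length → Label) i,
        D.circ s (e.get i) ∈ D.xCircles s (labelled e p) ↔ p i = .X := by
      intro p i
      simp only [xCircles, labelled, List.mem_ofFn, Prod.mk.injEq, Set.mem_ofPred_eq]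
      constructor
      · rintro ⟨_, ⟨j, rfl, hj⟩, hij⟩
        rwa [(he (e.get i)).unique (SameCircle.refl _ _) (circ_eq_iff.1 hij)]
      · exact fun h => ⟨_, ⟨i, rfl, h⟩, rfl⟩
    intro p q hpq
    funext i
    have := (key p i).symm.trans ((Set.ext_iff.1 hpq _).trans (key q i))
    cases hp : p i <;> cases hq : q i <;> simp_all
  have h₁ : LinearIndependent R fun p : Fin e.length → Label =>
      Finsupp.single (D.xCircles s (labelled e p)) (1 : R) :=
    (Finsupp.basisSingleOne (R := R) (ι := Set (D.Circle s))).linearIndependent.comp _ hinj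
  convert h₁.units_smul fun p =>
    Units.map (Int.castRingHom R).toMonoidHom (D.monomialSign s (labelled e p)) using 1
  funext p
  rw [Function.comp_apply, coordinates_wedge (by rwa [labelled_map_fst])]
  simp [Units.smul_def]

lemma span_wedge {e : List D.Half} (he : D.Enumerates s e) :
    Submodule.span R (Set.range fun p : Fin e.length → Label => D.wedge R s (labelled e p)) =
      ⊤ := by
  have key : ∀ m : D.Monomial s, (D.relations R s).mkQ (Finsupp.single m 1) ∈
      Submodule.span R (Set.range fun p : Fin e.length → Label => D.wedge R s (labelled e p)) := by
    intro m
    obtain ⟨l', ε, rfl, hε⟩ := RelStar.exists_normalForm m.1 e (m.2.map_perm he)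
    obtain ⟨p, hp⟩ := exists_labelled l'
    rw [← wedge_of_enumerates m.2, hε.wedge_eq]
    refine zsmul_mem (Submodule.subset_span ?_) ε
    exact ⟨p, by simp only [hp]⟩
  rw [eq_top_iff]
  rintro v -
  obtain ⟨v, rfl⟩ := (D.relations R s).mkQ_surjective v
  induction v using Finsupp.induction_linear with
  | zero => rw [map_zero]; exact zero_mem _
  | add v w hv hw => rw [map_add]; exact add_mem hv hw
  | single m r =>
    rw [← mul_one r, ← smul_eq_mul, ← Finsupp.smul_single, map_smul]
    exact Submodule.smul_mem _ r (key m)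

/-- The basis of the space of a state given by an enumeration of its circles. -/
noncomputable def wedgeBasis (R : Type*) [Ring R] {e : List D.Half} (he : D.Enumerates s e) :
    Module.Basis (Fin e.length → Label) R (D.StateSpace R s) :=
  .mk (linearIndependent_wedge he) (span_wedge he).ge

lemma wedgeBasis_apply {e : List D.Half} (he : D.Enumerates s e) (p : Fin e.length → Label) :
    wedgeBasis R he p = D.wedge R s (labelled e p) := by
  simp [wedgeBasis]

/-- A linear map is determined by the monomials with a fixed enumeration of the circles. -/
lemma linearMap_ext {M : Type*} [AddCommGroup M] [Module R M] {e : List D.Half}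
    (he : D.Enumerates s e) {φ ψ : D.StateSpace R s →ₗ[R] M}
    (h : ∀ l, l.map Prod.fst = e → φ (D.wedge R s l) = ψ (D.wedge R s l)) : φ = ψ :=
  (wedgeBasis R he).ext fun p => by
    rw [wedgeBasis_apply]; exact h _ (labelled_map_fst e p)

/-- A linear map on the space of a state may be defined on the monomials that start with prescribed
circles `w`, provided that the value respects the relations between the remaining factors. -/
lemma exists_linearMap {M : Type*} [AddCommGroup M] [Module R M] {w e : List D.Half}
    (he : D.Enumerates s (w ++ e)) (F : List (D.Half × Label) → List (D.Half × Label) → M)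
    (hF : ∀ v l l' ε, v.map Prod.fst = w → D.Enumerates s (w ++ l.map Prod.fst) →
      D.Rel s l l' ε → F v l = ε • F v l') :
    ∃ φ : D.StateSpace R s →ₗ[R] M, ∀ v l, v.map Prod.fst = w →
      D.Enumerates s (w ++ l.map Prod.fst) → φ (D.wedge R s (v ++ l)) = F v l := by
  refine ⟨(wedgeBasis R he).constr ℕ fun p =>
    F ((labelled _ p).take w.length) ((labelled _ p).drop w.length), fun v l hv hl => ?_⟩
  obtain ⟨l', ε, rfl, hε⟩ := RelStar.exists_normalForm (s := s) l e (by
    have := hl.map_perm he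
    rwa [List.map_append, List.map_append, List.perm_append_left_iff] at this)
  have hFε : F v l = ε • F v l' := by
    clear he
    induction hε with
    | refl => simp
    | head h₁ _ ih =>
      rw [hF v _ _ _ hv hl h₁, ih, mul_smul]
      refine hl.perm ?_
      simp only [List.map_append]
      exact h₁.circles_perm.append_left _
  rw [(hε.append_left v).wedge_eq, hFε, map_zsmul]
  congr 1
  subst hv
  obtain ⟨p, hp⟩ : ∃ p, labelled (v.map Prod.fst ++ l'.map Prod.fst) p = v ++ l' := by
    rw [← List.map_append]; exact exists_labelled _
  rw [← hp, ← wedgeBasis_apply he p, Module.Basis.constr_basis, hp]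
  simp

end VirtualDiagram

/-! ### The bigrading -/

/-- A basis with a degree function decomposes a module into the spans of the basis vectors of fixed
degree. -/
lemma Module.Basis.isInternal_span_of_degree {R M ι κ : Type*} [Ring R] [AddCommGroup M]
    [Module R M] [DecidableEq κ] (b : Module.Basis ι R M) (deg : ι → κ) :
    DirectSum.IsInternal fun k => Submodule.span R (b '' {i | deg i = k}) := by
  refine DirectSum.isInternal_submodule_of_iSupIndep_of_iSup_eq_top ?_ ?_
  · intro k
    have h : ⨆ j, ⨆ (_ : j ≠ k), Submodule.span R (b '' {i | deg i = j}) ≤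
        Submodule.span R (b '' {i | deg i ≠ k}) :=
      iSup₂_le fun j hj => Submodule.span_mono
        (Set.image_mono fun i hi => by rw [Set.mem_ofPred_eq] at hi ⊢; rwa [hi])
    refine (b.linearIndependent.disjoint_span_image ?_).mono_right h
    exact Set.disjoint_left.2 fun i hi hi' => hi' hi
  · rw [eq_top_iff, ← b.span_eq, Submodule.span_le]
    rintro _ ⟨i, rfl⟩
    exact Submodule.mem_iSup_of_mem (deg i) (Submodule.subset_span ⟨i, rfl, rfl⟩)

namespace VirtualDiagram

variable {D : VirtualDiagram} {s t u t' : D.State} {R : Type*} [Ring R]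
  {l l' : List (D.Half × Label)} {ε : ℤ}

/-- The additive group structure of the chain space, over its structure of a direct sum of
modules. -/
noncomputable instance (R : Type*) [Ring R] (D : VirtualDiagram) : AddCommGroup (D.Chains R) :=
  inferInstanceAs (AddCommGroup (@DirectSum D.State (fun s => D.StateSpace R s) fun s =>
    (Submodule.Quotient.addCommGroup (D.relations R s)).toAddCommMonoid))

lemma grading_eq_of_labels_perm (h : (l.map Prod.snd).Perm (l'.map Prod.snd)) :
    D.grading s l = D.grading s l' := by
  simp only [grading, h.count_eq]

lemma exists_enumerates (s : D.State) : ∃ e, D.Enumerates s e :=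
  exists_enumerates_append [] (by simp)

/-- Every bigraded piece is spanned by the monomials with fixed enumerations of the circles. -/
lemma bigradedPiece_eq_span (e : D.State → List D.Half) (he : ∀ s, D.Enumerates s (e s)) (i : ℕ)
    (j : ℤ) : D.bigradedPiece R i j = Submodule.span R {y | ∃ s l, l.map Prod.fst = e s ∧
      D.height s = i ∧ D.grading s l = j ∧ y = D.inclusion R s (D.wedge R s l)} := by
  refine le_antisymm (Submodule.span_le.2 ?_) (Submodule.span_mono ?_)
  · rintro _ ⟨s, l, hl, hi, hj, rfl⟩
    obtain ⟨l', ε, hl', hε⟩ := RelStar.exists_normalForm l (e s) (hl.map_perm (he s))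
    rw [hε.wedge_eq, map_zsmul]
    refine zsmul_mem (Submodule.subset_span ?_) ε
    exact ⟨s, l', hl', hi, by rw [← hj, grading_eq_of_labels_perm hε.labels_perm], rfl⟩
  · rintro _ ⟨s, l, hl, hi, hj, rfl⟩
    exact ⟨s, l, hl ▸ he s, hi, hj, rfl⟩

lemma isInternal_bigradedPiece (R : Type*) [Ring R] (D : VirtualDiagram) :
    DirectSum.IsInternal fun ij : ℕ × ℤ => D.bigradedPiece R ij.1 ij.2 := by
  choose e he using fun s : D.State => exists_enumerates s
  let b : Module.Basis (Σ s : D.State, Fin (e s).length → Label) R (D.Chains R) :=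
    DFinsupp.basis fun s => wedgeBasis R (he s)
  have hb : ∀ k, b k = D.inclusion R k.1 (D.wedge R k.1 (labelled (e k.1) k.2)) := by
    intro k
    rw [← wedgeBasis_apply (he k.1)]
    change (DFinsupp.basis fun s => wedgeBasis R (he s)).repr.symm (Finsupp.single k 1) =
      DFinsupp.single k.1 ((wedgeBasis R (he k.1)).repr.symm (Finsupp.single k.2 1))
    simp [DFinsupp.basis]
  suffices h : (fun ij : ℕ × ℤ => D.bigradedPiece R ij.1 ij.2) = fun ij => Submodule.span R
      (b '' {k | (D.height k.1, D.grading k.1 (labelled (e k.1) k.2)) = ij}) by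
    rw [h]
    exact b.isInternal_span_of_degree _
  funext ⟨i, j⟩
  rw [bigradedPiece_eq_span e he]
  congr 1
  ext y
  constructor
  · rintro ⟨s, l, hl, hi, hj, rfl⟩
    obtain ⟨p, hp⟩ := exists_labelled l
    revert p
    rw [hl]
    rintro p rfl
    exact ⟨⟨s, p⟩, Prod.ext hi hj, hb _⟩
  · rintro ⟨⟨s, p⟩, hij, rfl⟩
    exact ⟨s, _, labelled_map_fst _ _, congrArg Prod.fst hij, congrArg Prod.snd hij, hb _⟩

end VirtualDiagram

namespace VirtualDiagram

variable {D : VirtualDiagram} {s t u t' : D.State} {x y z p q a a' b b' h : D.Half}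
  {R : Type*} [Ring R] {l l' : List (D.Half × Label)} {ε : ℤ}

/-! ### Multiplication by `X` -/

lemma exists_xMul (R : Type*) [Ring R] (D : VirtualDiagram) (s : D.State) (h : D.Half) :
    ∃ ξ : D.StateSpace R s →ₗ[R] D.StateSpace R s, ∀ l,
      ξ (D.wedge R s ((h, .one) :: l)) = D.wedge R s ((h, .X) :: l) ∧
      ξ (D.wedge R s ((h, .X) :: l)) = 0 := by
  classical
  obtain ⟨e, he⟩ := exists_enumerates_append (s := s) [h] (by simp)
  obtain ⟨ξ, hξ⟩ := exists_linearMap (R := R) he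
    (fun v l => if v = [(h, .one)] then D.wedge R s ((h, .X) :: l) else 0) <| by
      intro v l l' ε _ _ hl
      have := (hl.append_left [(h, Label.X)]).wedge_eq (R := R)
      split_ifs
      · exact this
      · simp
  refine ⟨ξ, fun l => ?_⟩
  by_cases hl : D.Enumerates s (h :: l.map Prod.fst)
  · exact ⟨by simpa using hξ [(h, .one)] l rfl hl, by simpa using hξ [(h, .X)] l rfl hl⟩
  · rw [wedge_of_not_enumerates (l := (h, .one) :: l) hl,
      wedge_of_not_enumerates (l := (h, .X) :: l) hl]
    simp

/-- Multiplication by `X` on the circle through `h`, with the orientation given by `h`: it sends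
`1` to `X` and `X` to `0` in the factor of this circle. -/
noncomputable def xMul (R : Type*) [Ring R] (D : VirtualDiagram) (s : D.State) (h : D.Half) :
    D.StateSpace R s →ₗ[R] D.StateSpace R s := (exists_xMul R D s h).choose

lemma wedge_middle (x : D.Half × Label) (l l' : List (D.Half × Label)) :
    D.wedge R s (l ++ x :: l') = (-1 : ℤ) ^ l.length • D.wedge R s (x :: (l ++ l')) :=
  (RelStar.move x l l').wedge_eq

lemma xMul_one (w l : List (D.Half × Label)) :
    D.xMul R s h (D.wedge R s (w ++ (h, .one) :: l)) = D.wedge R s (w ++ (h, .X) :: l) := by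
  rw [wedge_middle, wedge_middle, map_zsmul]
  exact congrArg _ ((exists_xMul R D s h).choose_spec _).1

lemma xMul_X (w l : List (D.Half × Label)) :
    D.xMul R s h (D.wedge R s (w ++ (h, .X) :: l)) = 0 := by
  rw [wedge_middle, map_zsmul]
  exact (congrArg _ ((exists_xMul R D s h).choose_spec _).2).trans (smul_zero _)

lemma xMul_cons_one (l : List (D.Half × Label)) :
    D.xMul R s h (D.wedge R s ((h, .one) :: l)) = D.wedge R s ((h, .X) :: l) :=
  xMul_one [] l

lemma xMul_cons_X (l : List (D.Half × Label)) :
    D.xMul R s h (D.wedge R s ((h, .X) :: l)) = 0 :=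
  xMul_X [] l

lemma exists_cons_of_map_fst_eq_cons {e : List D.Half} (hl : l.map Prod.fst = x :: e) :
    ∃ p l', l = (x, p) :: l' ∧ l'.map Prod.fst = e := by
  obtain ⟨⟨y, p⟩, l', rfl, rfl, hl'⟩ := List.map_eq_cons_iff.1 hl
  exact ⟨p, l', rfl, hl'⟩

lemma xMul_eq_of_sameOriented (h : D.SameOriented s x y) : D.xMul R s x = D.xMul R s y := by
  obtain ⟨e, he⟩ := exists_enumerates_append (s := s) [x] (by simp)
  refine linearMap_ext he fun l hl => ?_
  obtain ⟨p, l, rfl, -⟩ := exists_cons_of_map_fst_eq_cons hl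
  have hs p : D.wedge R s ((x, p) :: l) = D.wedge R s ((y, p) :: l) := by
    simpa using (Rel.same [] x y p l h).wedge_eq (R := R)
  cases p
  · rw [xMul_cons_one, hs, hs, xMul_cons_one]
  · rw [xMul_cons_X, hs, xMul_cons_X]

lemma xMul_eq_neg (h : D.SameOriented s x (D.edge y)) : D.xMul R s x = - D.xMul R s y := by
  obtain ⟨e, he⟩ := exists_enumerates_append (s := s) [x] (by simp)
  refine linearMap_ext he fun l hl => ?_
  obtain ⟨p, l, rfl, -⟩ := exists_cons_of_map_fst_eq_cons hl
  have hone : D.wedge R s ((x, .one) :: l) = D.wedge R s ((y, .one) :: l) := by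
    simpa using (Rel.reverse_one [] x y l (oppositelyOriented_iff.2 h)).wedge_eq (R := R)
  have hX : D.wedge R s ((x, .X) :: l) = - D.wedge R s ((y, .X) :: l) := by
    simpa using (Rel.reverse_X [] x y l (oppositelyOriented_iff.2 h)).wedge_eq (R := R)
  cases p
  · rw [xMul_cons_one, LinearMap.neg_apply, hone, xMul_cons_one, hX]
  · rw [xMul_cons_X, LinearMap.neg_apply, hX, map_neg, xMul_cons_X, neg_zero, neg_zero]

lemma xMul_comm (x y : D.Half) (v : D.StateSpace R s) :
    D.xMul R s x (D.xMul R s y v) = D.xMul R s y (D.xMul R s x v) := by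
  by_cases h : D.SameCircle s x y
  · rw [sameCircle_iff] at h
    rcases h with h | h
    · rw [xMul_eq_of_sameOriented h]
    · simp [xMul_eq_neg h]
  · obtain ⟨e, he⟩ := exists_enumerates_append (s := s) [x, y] (by simpa [circ_eq_iff] using h)
    suffices D.xMul R s x ∘ₗ D.xMul R s y = D.xMul R s y ∘ₗ D.xMul R s x from
      LinearMap.congr_fun this v
    refine linearMap_ext he fun l hl => ?_
    obtain ⟨p, l, rfl, hl₁⟩ := exists_cons_of_map_fst_eq_cons hl
    obtain ⟨q, l, rfl, -⟩ := exists_cons_of_map_fst_eq_cons hl₁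
    have h₁ := fun p => xMul_one (R := R) (s := s) (h := y) [(x, p)] l
    have h₂ := fun p => xMul_X (R := R) (s := s) (h := y) [(x, p)] l
    have h₃ := fun q => xMul_one (R := R) (s := s) (h := x) [] ((y, q) :: l)
    have h₄ := fun q => xMul_X (R := R) (s := s) (h := x) [] ((y, q) :: l)
    simp only [List.cons_append, List.nil_append] at h₁ h₂ h₃ h₄
    cases p <;> cases q <;> simp only [LinearMap.comp_apply, h₁, h₂, h₃, h₄, map_zero]

/-- The product `1 ∧ ⋯ ∧ 1`.  It depends only on the order of the circles, up to sign. -/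
noncomputable def ones (R : Type*) [Ring R] (D : VirtualDiagram) (s : D.State)
    (e : List D.Half) : D.StateSpace R s := D.wedge R s (e.map fun h => (h, .one))

lemma ones_swap (w e : List D.Half) (x y : D.Half) :
    D.ones R s (w ++ x :: y :: e) = - D.ones R s (w ++ y :: x :: e) := by
  simpa [ones] using
    (Rel.swap (s := s) (w.map fun h => (h, .one)) (x, .one) (y, .one)
      (e.map fun h => (h, .one))).wedge_eq (R := R)

lemma ones_congr (w e : List D.Half) (h : D.SameCircle s x y) :
    D.ones R s (w ++ x :: e) = D.ones R s (w ++ y :: e) := by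
  rcases h with h | h
  · simpa [ones] using
      (Rel.same (w.map fun h => (h, .one)) x y .one (e.map fun h => (h, .one)) h).wedge_eq
        (R := R)
  · simpa [ones] using
      (Rel.reverse_one (w.map fun h => (h, .one)) x y (e.map fun h => (h, .one)) h).wedge_eq
        (R := R)

/-- The space of a state is generated by `1 ∧ ⋯ ∧ 1` under the multiplications by `X`. -/
lemma linearMap_ext_ones {φ ψ : D.StateSpace R s →ₗ[R] D.StateSpace R t}
    (hφ : ∀ h v, φ (D.xMul R s h v) = D.xMul R t h (φ v))
    (hψ : ∀ h v, ψ (D.xMul R s h v) = D.xMul R t h (ψ v)) {e : List D.Half}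
    (he : D.Enumerates s e) (heq : φ (D.ones R s e) = ψ (D.ones R s e)) : φ = ψ := by
  have key : ∀ (l : List (D.Half × Label)) (w : List D.Half), w ++ l.map Prod.fst = e →
      φ (D.wedge R s (w.map (fun h => (h, .one)) ++ l)) =
        ψ (D.wedge R s (w.map (fun h => (h, .one)) ++ l)) := by
    intro l
    induction l with
    | nil =>
      rintro w rfl
      simpa [ones] using heq
    | cons x l ih =>
      rintro w rfl
      have h₁ := ih (w ++ [x.1]) (by simp)
      simp only [List.map_append, List.map_cons, List.map_nil, List.append_assoc,
        List.singleton_append] at h₁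
      obtain ⟨h, _ | _⟩ := x
      · exact h₁
      · rw [← xMul_one, hφ, hψ, h₁]
  exact linearMap_ext he fun l hl => key l [] hl

/-! ### The partial differentials -/

lemma enumerates_iff_pairwise {e : List D.Half} :
    D.Enumerates s e ↔ e.Pairwise (fun x y => ¬ D.SameCircle s x y) ∧
      ∀ x, ∃ y ∈ e, D.SameCircle s y x := by
  rw [enumerates_iff, List.Nodup, List.pairwise_map, (circ_surjective s).forall]
  simp only [ne_eq, circ_eq_iff, List.mem_map]

/-- A `2 → 1` bifurcation replaces the two circles at the crossing by one. -/
lemma Surgery.enumerates_iff_of_merge (S : D.Surgery s t p q) (h : ¬ D.SameCircle s p q)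
    {e : List D.Half} : D.Enumerates t (p :: e) ↔ D.Enumerates s (p :: q :: e) := by
  simp only [enumerates_iff_pairwise, List.pairwise_cons, List.mem_cons, exists_eq_or_imp,
    forall_eq_or_imp, S.sameCircle_iff_of_merge h, not_or]
  have hp := SameCircle.refl s p
  have hq := SameCircle.refl s q
  constructor
  · rintro ⟨⟨h₁, h₂⟩, h₃⟩
    refine ⟨⟨⟨h, fun x hx => (h₁ x hx).1⟩, fun x hx hqx => ?_, h₂.imp fun h => h.1⟩, fun x => ?_⟩
    · exact (h₁ x hx).2 ⟨.inl hp, .inr hqx.symm⟩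
    · rcases h₃ x with (h₃ | ⟨-, h₃ | h₃⟩) | ⟨y, hy, h₃ | ⟨h₃, h₄ | h₄⟩⟩
      · exact .inl h₃
      · exact .inl h₃.symm
      · exact .inr (.inl h₃.symm)
      · exact .inr (.inr ⟨y, hy, h₃⟩)
      · exact .inl h₄.symm
      · exact .inr (.inl h₄.symm)
  · rintro ⟨⟨⟨-, h₁⟩, h₂, h₃⟩, h₄⟩
    have key : ∀ x ∈ e, ¬ (D.SameCircle s x p ∨ D.SameCircle s x q) := fun x hx hx' =>
      hx'.elim (fun h => h₁ x hx h.symm) fun h => h₂ x hx h.symm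
    refine ⟨⟨fun x hx => ⟨h₁ x hx, fun h => key x hx h.2⟩, ?_⟩, fun x => ?_⟩
    · exact h₃.imp_of_mem fun hx _ hxy => ⟨hxy, fun h' => key _ hx h'.1⟩
    · rcases h₄ x with h₄ | h₄ | ⟨y, hy, h₄⟩
      · exact .inl (.inl h₄)
      · exact .inl (.inr ⟨.inl hp, .inr h₄.symm⟩)
      · exact .inr ⟨y, hy, .inl h₄⟩

/-- A relation in the state `s` also holds in `t` if the circles that occur in it are contained in
circles of `t`, compatibly with orientations. -/
lemma Rel.transfer (h : D.Rel s l l' ε)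
    (hst : ∀ x ∈ l.map Prod.fst, ∀ y, D.SameOriented s x y → D.SameOriented t x y) :
    D.Rel t l l' ε := by
  cases h with
  | swap l a b l' => exact .swap l a b l'
  | same l h h' p l' hh => exact .same l h h' p l' (hst _ (by simp) _ hh)
  | reverse_one l h h' l' hh =>
    rw [oppositelyOriented_iff] at hh
    exact .reverse_one l h h' l' (oppositelyOriented_iff.2 (hst _ (by simp) _ hh))
  | reverse_X l h h' l' hh =>
    rw [oppositelyOriented_iff] at hh
    exact .reverse_X l h h' l' (oppositelyOriented_iff.2 (hst _ (by simp) _ hh))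

/-- In the local orientation at a crossing, the half-edges `first` and `second` are the incoming
ends of the two arcs, before and after the change of the smoothing. -/
lemma surgery_of_cubeEdge {c : Fin D.classical} (h : D.CubeEdge c s t) :
    D.Surgery s t (D.first c) (D.second c) := by
  obtain ⟨hs, ht, hx⟩ := h
  have hne : ∀ h : D.Half, h ≠ .upper (.inl c) .left → h ≠ .upper (.inl c) .right →
      h ≠ .lower (.inl c) .left → h ≠ .lower (.inl c) .right → D.arc t h = D.arc s h := by
    rintro (⟨x | v, i⟩ | ⟨x | v, i⟩ | ⟨k, b⟩) h₁ h₂ h₃ h₄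
    · have : x ≠ c := by rintro rfl; cases i <;> simp_all
      simp [arc, hx x this]
    · simp [arc]
    · have : x ≠ c := by rintro rfl; cases i <;> simp_all
      simp [arc, hx x this]
    · simp [arc]
    · simp [arc]
  cases hc : D.sign c
  · constructor <;> simp [first, second, arc, IsLeftRight, hs, ht, hc, Side.flip]
    exact fun h h₁ h₂ h₃ h₄ => hne h h₁ h₄ h₃ h₂
  · constructor <;> simp [first, second, arc, IsLeftRight, hs, ht, hc, Side.flip]
    exact fun h h₁ h₂ h₃ h₄ => hne h h₁ h₃ h₄ h₂

/-- The properties that characterise the partial differential of a surgery at `p` and `q`: it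
commutes with the multiplications by `X`, and the image of `1 ∧ ⋯ ∧ 1` is prescribed. -/
structure IsSurgeryMap (R : Type*) [Ring R] (D : VirtualDiagram) (s t : D.State) (p q : D.Half)
    (φ : D.StateSpace R s →ₗ[R] D.StateSpace R t) : Prop where
  comm : ∀ h v, φ (D.xMul R s h v) = D.xMul R t h (φ v)
  merge : ¬ D.SameCircle s p q → ∀ e, D.Enumerates s (p :: q :: e) →
    φ (D.ones R s (p :: q :: e)) = D.ones R t (p :: e)
  split : D.SameOriented s p q → ∀ e, D.Enumerates s (p :: e) →
    φ (D.ones R s (p :: e)) =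
      D.xMul R t p (D.ones R t (p :: q :: e)) + D.xMul R t q (D.ones R t (p :: q :: e))
  single : D.SameOriented s p (D.edge q) → φ = 0

/-- The conditions at `1 ∧ ⋯ ∧ 1` determine a partial differential. -/
lemma IsSurgeryMap.eq {φ ψ : D.StateSpace R s →ₗ[R] D.StateSpace R t}
    (hφ : D.IsSurgeryMap R s t p q φ) (hψ : D.IsSurgeryMap R s t p q ψ) : φ = ψ := by
  by_cases h : D.SameCircle s p q
  · rw [sameCircle_iff] at h
    rcases h with h | h
    · obtain ⟨e, he⟩ := exists_enumerates_append (s := s) [p] (by simp)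
      exact linearMap_ext_ones hφ.comm hψ.comm he ((hφ.split h e he).trans (hψ.split h e he).symm)
    · rw [hφ.single h, hψ.single h]
  · obtain ⟨e, he⟩ := exists_enumerates_append (s := s) [p, q] (by simpa [circ_eq_iff] using h)
    exact linearMap_ext_ones hφ.comm hψ.comm he ((hφ.merge h e he).trans (hψ.merge h e he).symm)

/-- To commute with all multiplications by `X`, it suffices to commute with those of one half-edge
of each circle, in one of its orientations. -/
lemma comm_of_sameCircle {φ : D.StateSpace R s →ₗ[R] D.StateSpace R t}
    (hy : D.SameOriented t x y ∧ D.SameOriented s x z ∨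
      D.SameOriented t x (D.edge y) ∧ D.SameOriented s x (D.edge z))
    (h : φ ∘ₗ D.xMul R s z = D.xMul R t y ∘ₗ φ) (v : D.StateSpace R s) :
    φ (D.xMul R s x v) = D.xMul R t x (φ v) := by
  have hv : φ (D.xMul R s z v) = D.xMul R t y (φ v) := LinearMap.congr_fun h v
  rcases hy with ⟨h₁, h₂⟩ | ⟨h₁, h₂⟩
  · rw [xMul_eq_of_sameOriented h₁, xMul_eq_of_sameOriented h₂, hv]
  · simp [xMul_eq_neg h₁, xMul_eq_neg h₂, hv]

variable {c : Fin D.classical} {φ : D.StateSpace R s →ₗ[R] D.StateSpace R t}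

/-- The circle through `x` is the first circle at the crossing, or the second one, or remains
unchanged. -/
lemma IsMultiplication.comm (hm : D.IsMultiplication R c s t φ)
    (S : D.Surgery s t (D.first c) (D.second c)) (h : ¬ D.SameCircle s (D.first c) (D.second c))
    (x : D.Half) (v : D.StateSpace R s) : φ (D.xMul R s x v) = D.xMul R t x (φ v) := by
  obtain ⟨f1, f2, f3, f4⟩ := hm
  generalize D.first c = p at *
  generalize D.second c = q at *
  have hn : (([p, q] : List D.Half).map (D.circ s)).Nodup := by simpa [circ_eq_iff] using h
  have m1 := fun i l => xMul_one (R := R) (s := s) (h := q) [(p, i)] l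
  have m2 := fun i l => xMul_X (R := R) (s := s) (h := q) [(p, i)] l
  have m3 := fun l => xMul_one (R := R) (s := s) (h := p) [] l
  have m4 := fun l => xMul_X (R := R) (s := s) (h := p) [] l
  have m5 := fun l => xMul_one (R := R) (s := t) (h := p) [] l
  have m6 := fun l => xMul_X (R := R) (s := t) (h := p) [] l
  simp only [List.cons_append, List.nil_append] at m1 m2 m3 m4 m5 m6
  by_cases hp : D.SameCircle s x p
  · refine comm_of_sameCircle (y := p) (z := p) ?_ ?_ v
    · rw [sameCircle_iff] at hp
      exact hp.imp (fun h' => ⟨S.le_of_merge h h', h'⟩) fun h' => ⟨S.le_of_merge h h', h'⟩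
    obtain ⟨e, he⟩ := exists_enumerates_append [p, q] hn
    refine linearMap_ext he fun l hl => ?_
    obtain ⟨i, l, rfl, hl₁⟩ := exists_cons_of_map_fst_eq_cons hl
    obtain ⟨j, l, rfl, hl₂⟩ := exists_cons_of_map_fst_eq_cons hl₁
    change _ = e at hl₂
    subst hl₂
    cases i <;> cases j <;>
      simp only [LinearMap.comp_apply, m3, m4, m5, m6, f1 l he, f2 l he, f3 l he, f4 l he, map_zero]
  by_cases hq : D.SameCircle s x q
  · refine comm_of_sameCircle (y := p) (z := q) ?_ ?_ v
    · rw [sameCircle_iff] at hq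
      have hpq := (S.sameOriented_of_merge h).symm
      exact hq.imp (fun h' => ⟨(S.le_of_merge h h').trans hpq, h'⟩)
        fun h' => ⟨(S.le_of_merge h h').trans hpq.edge, h'⟩
    obtain ⟨e, he⟩ := exists_enumerates_append [p, q] hn
    refine linearMap_ext he fun l hl => ?_
    obtain ⟨i, l, rfl, hl₁⟩ := exists_cons_of_map_fst_eq_cons hl
    obtain ⟨j, l, rfl, hl₂⟩ := exists_cons_of_map_fst_eq_cons hl₁
    change _ = e at hl₂
    subst hl₂
    cases i <;> cases j <;>
      simp only [LinearMap.comp_apply, m1, m2, m5, m6, f1 l he, f2 l he, f3 l he, f4 l he, map_zero]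
  · obtain ⟨e, he⟩ := exists_enumerates_append (s := s) [p, q, x] (by
      have h₁ : ¬ D.SameCircle s p x := fun h' => hp h'.symm
      have h₂ : ¬ D.SameCircle s q x := fun h' => hq h'.symm
      simp [circ_eq_iff, h, h₁, h₂])
    suffices φ ∘ₗ D.xMul R s x = D.xMul R t x ∘ₗ φ from LinearMap.congr_fun this v
    refine linearMap_ext he fun l hl => ?_
    obtain ⟨i, l, rfl, hl₁⟩ := exists_cons_of_map_fst_eq_cons hl
    obtain ⟨j, l, rfl, hl₂⟩ := exists_cons_of_map_fst_eq_cons hl₁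
    obtain ⟨k, l, rfl, hl₃⟩ := exists_cons_of_map_fst_eq_cons hl₂
    change _ = e at hl₃
    subst hl₃
    have n1 := xMul_one (R := R) (s := s) (h := x) [(p, i), (q, j)] l
    have n2 := xMul_X (R := R) (s := s) (h := x) [(p, i), (q, j)] l
    have n3 := fun i => xMul_one (R := R) (s := t) (h := x) [(p, i)] l
    have n4 := fun i => xMul_X (R := R) (s := t) (h := x) [(p, i)] l
    simp only [List.cons_append, List.nil_append] at n1 n2 n3 n4
    have g1 := fun k => f1 ((x, k) :: l) he
    have g2 := fun k => f2 ((x, k) :: l) he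
    have g3 := fun k => f3 ((x, k) :: l) he
    have g4 := fun k => f4 ((x, k) :: l) he
    cases i <;> cases j <;> cases k <;>
      simp only [LinearMap.comp_apply, n1, n2, n3, n4, g1, g2, g3, g4, map_zero]

/-- The orientation of a circle that is split induces the local orientation on both pieces. -/
lemma Surgery.split_orientation (S : D.Surgery s t p q) (h : D.SameOriented s p q)
    (hx : D.SameOriented s x p) : D.SameOriented t x p ∨ D.SameOriented t x q := by
  have hn := S.not_sameCircle_of_split h
  have hp := not_sameOriented_edge t p
  rw [S.inv.sameOriented_iff_of_merge hn] at hx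
  rw [sameCircle_iff] at hn
  tauto

/-- On the image of `Δ`, the multiplications by `X` on the two new circles agree. -/
lemma IsComultiplication.comm (hm : D.IsComultiplication R c s t φ)
    (S : D.Surgery s t (D.first c) (D.second c)) (h : D.SameOriented s (D.first c) (D.second c))
    (x : D.Half) (v : D.StateSpace R s) : φ (D.xMul R s x v) = D.xMul R t x (φ v) := by
  obtain ⟨f1, f2⟩ := hm
  generalize D.first c = p at *
  generalize D.second c = q at *
  have m1 := fun i l => xMul_one (R := R) (s := t) (h := q) [(p, i)] l
  have m2 := fun i l => xMul_X (R := R) (s := t) (h := q) [(p, i)] l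
  have m3 := fun l => xMul_one (R := R) (s := s) (h := p) [] l
  have m4 := fun l => xMul_X (R := R) (s := s) (h := p) [] l
  have m5 := fun l => xMul_one (R := R) (s := t) (h := p) [] l
  have m6 := fun l => xMul_X (R := R) (s := t) (h := p) [] l
  simp only [List.cons_append, List.nil_append] at m1 m2 m3 m4 m5 m6
  by_cases hp : D.SameCircle s x p
  · obtain ⟨e, he⟩ := exists_enumerates_append (s := s) [p] (by simp)
    have hφp : φ ∘ₗ D.xMul R s p = D.xMul R t p ∘ₗ φ := by
      refine linearMap_ext he fun l hl => ?_
      obtain ⟨i, l, rfl, hl₁⟩ := exists_cons_of_map_fst_eq_cons hl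
      change _ = e at hl₁
      subst hl₁
      cases i <;> simp only [LinearMap.comp_apply, m3, m4, m5, m6, f1 l he, f2 l he, map_zero,
        map_add, add_zero]
    have hφq : φ ∘ₗ D.xMul R s p = D.xMul R t q ∘ₗ φ := by
      refine linearMap_ext he fun l hl => ?_
      obtain ⟨i, l, rfl, hl₁⟩ := exists_cons_of_map_fst_eq_cons hl
      change _ = e at hl₁
      subst hl₁
      cases i <;> simp only [LinearMap.comp_apply, m1, m2, m3, m4, f1 l he, f2 l he,
        map_zero, map_add, zero_add]
    rw [sameCircle_iff] at hp
    rcases hp with hp | hp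
    · rcases S.split_orientation h hp with h' | h'
      · exact comm_of_sameCircle (.inl ⟨h', hp⟩) hφp v
      · exact comm_of_sameCircle (.inl ⟨h', hp⟩) hφq v
    · rcases S.split_orientation h (sameOriented_edge_left.2 hp) with h' | h'
      · exact comm_of_sameCircle (.inr ⟨sameOriented_edge_left.1 h', hp⟩) hφp v
      · exact comm_of_sameCircle (.inr ⟨sameOriented_edge_left.1 h', hp⟩) hφq v
  · obtain ⟨e, he⟩ := exists_enumerates_append (s := s) [p, x] (by
      have h₁ : ¬ D.SameCircle s p x := fun h' => hp h'.symm
      simp [circ_eq_iff, h₁])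
    suffices φ ∘ₗ D.xMul R s x = D.xMul R t x ∘ₗ φ from LinearMap.congr_fun this v
    refine linearMap_ext he fun l hl => ?_
    obtain ⟨i, l, rfl, hl₁⟩ := exists_cons_of_map_fst_eq_cons hl
    obtain ⟨k, l, rfl, hl₂⟩ := exists_cons_of_map_fst_eq_cons hl₁
    change _ = e at hl₂
    subst hl₂
    have n1 := fun i j => xMul_one (R := R) (s := t) (h := x) [(p, i), (q, j)] l
    have n2 := fun i j => xMul_X (R := R) (s := t) (h := x) [(p, i), (q, j)] l
    have n3 := xMul_one (R := R) (s := s) (h := x) [(p, i)] l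
    have n4 := xMul_X (R := R) (s := s) (h := x) [(p, i)] l
    simp only [List.cons_append, List.nil_append] at n1 n2 n3 n4
    have g1 := fun k => f1 ((x, k) :: l) he
    have g2 := fun k => f2 ((x, k) :: l) he
    cases i <;> cases k <;>
      simp only [LinearMap.comp_apply, n1, n2, n3, n4, g1, g2, map_zero, map_add, add_zero]

lemma IsPartialDifferential.isSurgeryMap (hφ : D.IsPartialDifferential R c s t φ)
    (S : D.Surgery s t (D.first c) (D.second c)) :
    D.IsSurgeryMap R s t (D.first c) (D.second c) φ := by
  have hmul (h : ¬ D.SameCircle s (D.first c) (D.second c)) : D.IsMultiplication R c s t φ :=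
    hφ.two_one h (S.sameOriented_of_merge h).sameCircle
  have hcomul (h : D.SameOriented s (D.first c) (D.second c)) : D.IsComultiplication R c s t φ :=
    hφ.one_two h.sameCircle (S.not_sameCircle_of_split h)
  have hsingle (h : D.SameOriented s (D.first c) (D.edge (D.second c))) : φ = 0 :=
    hφ.one_one (sameCircle_iff.2 (.inr h))
      (sameCircle_iff.2 (.inr (S.sameOriented_edge_of_single h)))
  refine ⟨?_, fun h e he => ?_, fun h e he => ?_, hsingle⟩
  · by_cases h : D.SameCircle s (D.first c) (D.second c)
    · rw [sameCircle_iff] at h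
      rcases h with h | h
      · exact (hcomul h).comm S h
      · simp [hsingle h]
    · exact (hmul h).comm S h
  · exact (hmul h).one_one (e.map fun h => (h, .one)) (by simpa [Function.comp_def] using he)
  · have := (hcomul h).one (e.map fun h => (h, .one)) (by simpa [Function.comp_def] using he)
    simp only [ones, List.map_cons]
    rw [this, add_comm]
    congr 1
    · exact (xMul_one [] _).symm
    · exact (xMul_one [(D.first c, .one)] _).symm

lemma exists_isMultiplication (R : Type*) [Ring R] (S : D.Surgery s t (D.first c) (D.second c))
    (h : ¬ D.SameCircle s (D.first c) (D.second c)) :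
    ∃ φ, D.IsMultiplication R c s t φ := by
  obtain ⟨e, he⟩ := exists_enumerates_append (s := s) [D.first c, D.second c]
    (by simpa [circ_eq_iff] using h)
  obtain ⟨φ, hφ⟩ := exists_linearMap (R := R) he
    (fun v l => match v.map Prod.snd with
      | [.one, .one] => D.wedge R t ((D.first c, .one) :: l)
      | [.X, .one] | [.one, .X] => D.wedge R t ((D.first c, .X) :: l)
      | _ => 0) <| by
    intro v l l' ε _ _ hl
    have hr : D.Rel t l l' ε := hl.transfer fun x _ y => S.le_of_merge h
    have h₁ := fun i => (hr.append_left [(D.first c, i)]).wedge_eq (R := R)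
    simp only [List.cons_append, List.nil_append] at h₁
    split <;> simp [h₁]
  exact ⟨φ, fun l => hφ [(D.first c, .one), (D.second c, .one)] l rfl,
    fun l => hφ [(D.first c, .X), (D.second c, .one)] l rfl,
    fun l => hφ [(D.first c, .one), (D.second c, .X)] l rfl,
    fun l => hφ [(D.first c, .X), (D.second c, .X)] l rfl⟩

lemma exists_isComultiplication (R : Type*) [Ring R]
    (S : D.Surgery s t (D.first c) (D.second c))
    (h : D.SameOriented s (D.first c) (D.second c)) :
    ∃ φ, D.IsComultiplication R c s t φ := by
  obtain ⟨e, he⟩ := exists_enumerates_append (s := s) [D.first c] (by simp)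
  obtain ⟨φ, hφ⟩ := exists_linearMap (R := R) he
    (fun v l => match v.map Prod.snd with
      | [.one] => D.wedge R t ((D.first c, .one) :: (D.second c, .X) :: l) +
          D.wedge R t ((D.first c, .X) :: (D.second c, .one) :: l)
      | _ => D.wedge R t ((D.first c, .X) :: (D.second c, .X) :: l)) <| by
    intro v l l' ε _ hl' hl
    have hr : D.Rel t l l' ε := hl.transfer fun x hx y hxy => by
      have hxp : ¬ D.SameCircle s x (D.first c) := fun h' =>
        (List.pairwise_cons.1 (enumerates_iff_pairwise.1 hl').1).1 x hx h'.symm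
      have hxq : ¬ D.SameCircle s x (D.second c) := fun h' => hxp (h'.trans h.symm.sameCircle)
      have hle := fun {x y} => S.inv.le_of_merge (S.not_sameCircle_of_split h) (x := x) (y := y)
      rw [sameCircle_iff, not_or] at hxp hxq
      rw [S.inv.sameOriented_iff_of_merge (S.not_sameCircle_of_split h)] at hxy
      rcases hxy with h' | ⟨h' | h', -⟩ | ⟨h' | h', -⟩
      · exact h'
      · exact absurd (hle h') hxp.1
      · exact absurd (hle h') hxq.1
      · exact absurd (hle h') hxp.2
      · exact absurd (hle h') hxq.2
    have h₁ := fun i j => (hr.append_left [(D.first c, i), (D.second c, j)]).wedge_eq (R := R)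
    simp only [List.cons_append, List.nil_append] at h₁
    split <;> simp [h₁]
  exact ⟨φ, fun l => hφ [(D.first c, .one)] l rfl, fun l => hφ [(D.first c, .X)] l rfl⟩

lemma exists_isPartialDifferential (R : Type*) [Ring R] (h : D.CubeEdge c s t) :
    ∃ φ, D.IsPartialDifferential R c s t φ := by
  have S := surgery_of_cubeEdge h
  by_cases h₁ : D.SameCircle s (D.first c) (D.second c)
  · rcases sameCircle_iff.1 h₁ with h₂ | h₂
    · obtain ⟨φ, hφ⟩ := exists_isComultiplication R S h₂
      exact ⟨φ, fun h' => absurd h₁ h', fun _ _ => hφ,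
        fun _ h' => absurd h' (S.not_sameCircle_of_split h₂)⟩
    · exact ⟨0, fun h' => absurd h₁ h',
        fun _ h' => absurd (sameCircle_iff.2 (.inr (S.sameOriented_edge_of_single h₂))) h',
        fun _ _ => rfl⟩
  · obtain ⟨φ, hφ⟩ := exists_isMultiplication R S h₁
    exact ⟨φ, fun _ _ => hφ, fun h' => absurd h' h₁, fun h' => absurd h' h₁⟩

end VirtualDiagram

namespace VirtualDiagram

variable {D : VirtualDiagram} {s t u t' : D.State} {x y z p q a a' b b' h : D.Half}
  {R : Type*} [Ring R] {e : List D.Half}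

/-! ### Anticommutativity of the faces -/

lemma ones_of_not_enumerates (h : ¬ D.Enumerates s e) : D.ones R s e = 0 :=
  wedge_of_not_enumerates (by simpa [Function.comp_def] using h)

namespace IsSurgeryMap

variable {φ : D.StateSpace R s →ₗ[R] D.StateSpace R t}

/-- The condition at `1 ∧ ⋯ ∧ 1` holds for all lists: where it is not imposed, both sides are
`0`. -/
lemma map_merge (hφ : D.IsSurgeryMap R s t p q φ) (S : D.Surgery s t p q)
    (h : ¬ D.SameCircle s p q) (e : List D.Half) :
    φ (D.ones R s (p :: q :: e)) = D.ones R t (p :: e) := by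
  by_cases he : D.Enumerates s (p :: q :: e)
  · exact hφ.merge h e he
  · rw [ones_of_not_enumerates he, map_zero,
      ones_of_not_enumerates (mt (S.enumerates_iff_of_merge h).1 he)]

lemma map_split (hφ : D.IsSurgeryMap R s t p q φ) (S : D.Surgery s t p q)
    (h : D.SameOriented s p q) (e : List D.Half) :
    φ (D.ones R s (p :: e)) =
      D.xMul R t p (D.ones R t (p :: q :: e)) + D.xMul R t q (D.ones R t (p :: q :: e)) := by
  by_cases he : D.Enumerates s (p :: e)
  · exact hφ.split h e he
  · rw [ones_of_not_enumerates he, ones_of_not_enumerates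
      (mt (S.inv.enumerates_iff_of_merge (S.not_sameCircle_of_split h)).2 he)]
    simp

end IsSurgeryMap

lemma ones_swap₀ (x y : D.Half) (e : List D.Half) :
    D.ones R s (x :: y :: e) = - D.ones R s (y :: x :: e) := ones_swap [] e x y

lemma ones_swap₁ (x y z : D.Half) (e : List D.Half) :
    D.ones R s (x :: y :: z :: e) = - D.ones R s (x :: z :: y :: e) := ones_swap [x] e y z

lemma ones_rotate (x y z : D.Half) (e : List D.Half) :
    D.ones R s (x :: y :: z :: e) = D.ones R s (y :: z :: x :: e) := by
  rw [ones_swap₀, ones_swap₁, neg_neg]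

lemma ones_swap_pairs (w x y z : D.Half) (e : List D.Half) :
    D.ones R s (w :: x :: y :: z :: e) = D.ones R s (y :: z :: w :: x :: e) := by
  have h := ones_swap (R := R) (s := s) [y, w] e x z
  simp only [List.cons_append, List.nil_append] at h
  rw [ones_swap₁ w x y, ones_swap₀ w y, neg_neg, h, ones_swap₁ y w z, neg_neg]

lemma ones_congr₀ (h : D.SameCircle s x y) (e : List D.Half) :
    D.ones R s (x :: e) = D.ones R s (y :: e) := ones_congr [] e h

lemma ones_congr₁ (h : D.SameCircle s x y) (z : D.Half) (e : List D.Half) :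
    D.ones R s (z :: x :: e) = D.ones R s (z :: y :: e) := ones_congr [z] e h

namespace IsSurgeryMap

variable {φ : D.StateSpace R s →ₗ[R] D.StateSpace R t}

/-- Interchanging the first and the second arc at a crossing changes the sign of the partial
differential. -/
lemma swap (hφ : D.IsSurgeryMap R s t p q φ) (S : D.Surgery s t p q) :
    D.IsSurgeryMap R s t q p (-φ) where
  comm h v := by simp [hφ.comm]
  merge h e _ := by
    have h' : ¬ D.SameCircle s p q := fun h' => h h'.symm
    rw [LinearMap.neg_apply, ones_swap₀, map_neg, neg_neg, hφ.map_merge S h',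
      ones_congr₀ (S.sameOriented_of_merge h').sameCircle]
  split h e _ := by
    rw [LinearMap.neg_apply, ones_congr₀ h.sameCircle, hφ.map_split S h.symm, ones_swap₀, map_neg,
      map_neg]
    abel
  single h := by
    rw [hφ.single (sameOriented_edge_left.1 h.symm), neg_zero]

/-- Reversing the local orientation at a crossing does not change the partial differential: when a
circle splits, the sign from `X` cancels against the sign from the order of the two new circles. -/
lemma reverse (hφ : D.IsSurgeryMap R s t p q φ) (S : D.Surgery s t p q) :
    D.IsSurgeryMap R s t (D.arc s p) (D.arc s q) φ where
  comm := hφ.comm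
  merge h e _ := by
    have hp := sameCircle_arc s p
    have hq := sameCircle_arc s q
    have h' : ¬ D.SameCircle s p q := fun h' => h ((hp.symm.trans h').trans hq)
    rw [ones_congr₀ hp.symm, ones_congr₁ hq.symm, hφ.map_merge S h',
      ones_congr₀ (S.circle_le_of_merge h' hp)]
  split h e _ := by
    rw [sameOriented_arc_arc] at h
    have hp : D.SameOriented t (D.arc s p) (D.edge q) := by
      rw [← S.arc_q]; exact sameOriented_edge_arc.symm
    have hq : D.SameOriented t (D.arc s q) (D.edge p) := by
      rw [← S.arc_p]; exact sameOriented_edge_arc.symm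
    rw [ones_congr₀ (sameCircle_arc s p).symm, hφ.map_split S h, xMul_eq_neg hp, xMul_eq_neg hq,
      ones_congr₀ (sameCircle_iff.2 (.inr hp)), ones_congr₁ (sameCircle_iff.2 (.inr hq)),
      ones_swap₀ q p]
    simp only [LinearMap.neg_apply, map_neg, neg_neg]
    abel
  single h := by
    refine hφ.single ?_
    rwa [sameOriented_arc_left, edge_edge, sameOriented_arc_right] at h

end IsSurgeryMap

/-- A `2`-face of the cube: two surgeries, at `a`, `a'` and at `b`, `b'`, that are carried out in
either order. -/
structure Face (D : VirtualDiagram) (s t t' u : D.State) (a a' b b' : D.Half) : Prop where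
  sa : D.Surgery s t a a'
  sb : D.Surgery s t' b b'
  ta : D.Surgery t' u a a'
  tb : D.Surgery t u b b'
  arc_a : ∀ x, x = a ∨ x = a' → D.arc t' x = D.arc s x
  arc_b : ∀ x, x = b ∨ x = b' → D.arc t x = D.arc s x

namespace Face

lemma flip (F : D.Face s t t' u a a' b b') : D.Face s t' t u b b' a a' :=
  ⟨F.sb, F.sa, F.tb, F.ta, F.arc_b, F.arc_a⟩

lemma swap (F : D.Face s t t' u a a' b b') : D.Face s t t' u a' a b b' :=
  ⟨F.sa.swap, F.sb, F.ta.swap, F.tb, fun x hx => F.arc_a x hx.symm, F.arc_b⟩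

lemma reverse (F : D.Face s t t' u a a' b b') :
    D.Face s t t' u (D.arc s a) (D.arc s a') b b' := by
  refine ⟨F.sa.reverse, F.sb, ?_, F.tb, ?_, F.arc_b⟩
  · rw [← F.arc_a a (.inl rfl), ← F.arc_a a' (.inr rfl)]
    exact F.ta.reverse
  · rintro _ (rfl | rfl)
    · rw [arc_arc, ← F.arc_a a (.inl rfl), arc_arc]
    · rw [arc_arc, ← F.arc_a a' (.inr rfl), arc_arc]

lemma inv (F : D.Face s t t' u a a' b b') : D.Face t s u t' a a' b b' := by
  refine ⟨F.sa.inv, F.tb, F.ta.inv, F.sb, ?_, fun x hx => (F.arc_b x hx).symm⟩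
  rintro _ (rfl | rfl)
  · rw [F.ta.arc_p, F.sa.arc_p, F.arc_a _ (.inr rfl)]
  · rw [F.ta.arc_q, F.sa.arc_q, F.arc_a _ (.inl rfl)]

end Face

/-- The partial differentials along the two paths around a face have opposite composites. -/
def FaceAnticommutes (R : Type*) [Ring R] (D : VirtualDiagram) (s t t' u : D.State)
    (a a' b b' : D.Half) : Prop :=
  ∀ φ ψ φ' ψ', D.IsSurgeryMap R s t a a' φ → D.IsSurgeryMap R t u b b' ψ →
    D.IsSurgeryMap R s t' b b' φ' → D.IsSurgeryMap R t' u a a' ψ' → ψ ∘ₗ φ + ψ' ∘ₗ φ' = 0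

namespace FaceAnticommutes

lemma of_flip (H : D.FaceAnticommutes R s t' t u b b' a a') :
    D.FaceAnticommutes R s t t' u a a' b b' := fun φ ψ φ' ψ' h₁ h₂ h₃ h₄ => by
  rw [add_comm]
  exact H φ' ψ' φ ψ h₃ h₄ h₁ h₂

lemma of_swap (F : D.Face s t t' u a a' b b') (H : D.FaceAnticommutes R s t t' u a' a b b') :
    D.FaceAnticommutes R s t t' u a a' b b' := fun φ ψ φ' ψ' h₁ h₂ h₃ h₄ => by
  have := H (-φ) ψ φ' (-ψ') (h₁.swap F.sa) h₂ h₃ (h₄.swap F.ta)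
  rw [LinearMap.comp_neg, LinearMap.neg_comp, ← neg_add, neg_eq_zero] at this
  exact this

lemma of_reverse (F : D.Face s t t' u a a' b b')
    (H : D.FaceAnticommutes R s t t' u (D.arc s a) (D.arc s a') b b') :
    D.FaceAnticommutes R s t t' u a a' b b' := fun φ ψ φ' ψ' h₁ h₂ h₃ h₄ => by
  refine H φ ψ φ' ψ' (h₁.reverse F.sa) h₂ h₃ ?_
  rw [← F.arc_a a (.inl rfl), ← F.arc_a a' (.inr rfl)]
  exact h₄.reverse F.ta

lemma of_swap' (F : D.Face s t t' u a a' b b') (H : D.FaceAnticommutes R s t t' u a a' b' b) :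
    D.FaceAnticommutes R s t t' u a a' b b' :=
  of_flip (of_swap F.flip (of_flip H))

lemma of_reverse' (F : D.Face s t t' u a a' b b')
    (H : D.FaceAnticommutes R s t t' u a a' (D.arc s b) (D.arc s b')) :
    D.FaceAnticommutes R s t t' u a a' b b' :=
  of_flip (of_reverse F.flip (of_flip H))

/-- Both composites around a face commute with the multiplications by `X`, so that it suffices to
compare them on `1 ∧ ⋯ ∧ 1`. -/
lemma of_ones (he : D.Enumerates s e)
    (H : ∀ φ ψ φ' ψ', D.IsSurgeryMap R s t a a' φ → D.IsSurgeryMap R t u b b' ψ →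
      D.IsSurgeryMap R s t' b b' φ' → D.IsSurgeryMap R t' u a a' ψ' →
      ψ (φ (D.ones R s e)) = - ψ' (φ' (D.ones R s e))) :
    D.FaceAnticommutes R s t t' u a a' b b' := fun φ ψ φ' ψ' h₁ h₂ h₃ h₄ => by
  rw [← eq_neg_iff_add_eq_zero]
  refine linearMap_ext_ones (fun h v => ?_) (fun h v => ?_) he ?_
  · simp [h₁.comm, h₂.comm]
  · simp [h₃.comm, h₄.comm]
  · simpa using H φ ψ φ' ψ' h₁ h₂ h₃ h₄

variable (F : D.Face s t t' u a a' b b')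

include F

/-- Two crossings at which four different circles meet. -/
lemma merge_merge_far (ha : ¬ D.SameCircle s a a') (hb : ¬ D.SameCircle s b b')
    (h₁ : ¬ D.SameCircle s a b) (h₂ : ¬ D.SameCircle s a b') (h₃ : ¬ D.SameCircle s a' b)
    (h₄ : ¬ D.SameCircle s a' b') : D.FaceAnticommutes R s t t' u a a' b b' := by
  obtain ⟨e, he⟩ := exists_enumerates_append (s := s) [a, a', b, b'] (by
    simp [circ_eq_iff, ha, hb, h₁, h₂, h₃, h₄])
  refine of_ones he fun φ ψ φ' ψ' hφ hψ hφ' hψ' => ?_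
  have hb' : ¬ D.SameCircle t b b' := by
    rw [F.sa.sameCircle_iff_of_merge ha, sameCircle_comm (y := a), sameCircle_comm (y := a')]
    tauto
  have ha' : ¬ D.SameCircle t' a a' := by
    rw [F.sb.sameCircle_iff_of_merge hb]
    tauto
  simp only [List.cons_append, List.nil_append]
  rw [hφ.map_merge F.sa ha, ones_rotate, hψ.map_merge F.tb hb', ones_swap_pairs,
    hφ'.map_merge F.sb hb, ones_rotate, hψ'.map_merge F.ta ha', ones_swap₀]

/-- Two crossings at which three circles meet, merged to a single one. -/
lemma merge_merge_near (ha : ¬ D.SameCircle s a a') (hab : D.SameCircle s a b)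
    (h₁ : ¬ D.SameCircle s b' a) (h₂ : ¬ D.SameCircle s b' a') :
    D.FaceAnticommutes R s t t' u a a' b b' := by
  have hb : ¬ D.SameCircle s b b' := fun h => h₁ (hab.trans h).symm
  obtain ⟨e, he⟩ := exists_enumerates_append (s := s) [a, a', b'] (by
    rw [sameCircle_comm] at h₁ h₂
    simp [circ_eq_iff, ha, h₁, h₂])
  refine of_ones he fun φ ψ φ' ψ' hφ hψ hφ' hψ' => ?_
  have hb' : ¬ D.SameCircle t b b' := by
    rw [F.sa.sameCircle_iff_of_merge ha]
    tauto
  have ha' : ¬ D.SameCircle t' a a' := by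
    rw [F.sb.sameCircle_iff_of_merge hb, sameCircle_comm (x := a') (y := b')]
    have : ¬ D.SameCircle s a' b := fun h => ha (hab.trans h.symm)
    tauto
  have hu := F.ta.circle_le_of_merge ha' (F.sb.circle_le_of_merge hb hab)
  simp only [List.cons_append, List.nil_append]
  rw [hφ.map_merge F.sa ha, ones_congr₀ (F.sa.circle_le_of_merge ha hab),
    hψ.map_merge F.tb hb', ones_swap₁, ones_congr₀ hab, map_neg, hφ'.map_merge F.sb hb,
    ones_congr₀ (F.sb.circle_le_of_merge hb hab.symm), map_neg, hψ'.map_merge F.ta ha', neg_neg,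
    ones_congr₀ hu]

/-- Two crossings at which the same two circles meet. -/
lemma merge_merge_double (ha : ¬ D.SameCircle s a a') (hab : D.SameOriented s a b)
    (hab' : D.SameCircle s a' b') : D.FaceAnticommutes R s t t' u a a' b b' := by
  have hb : ¬ D.SameCircle s b b' := fun h => ha ((hab.sameCircle.trans h).trans hab'.symm)
  have hta := F.sa.sameOriented_of_merge ha
  have htb := F.sb.sameOriented_of_merge hb
  have ht := F.sa.le_of_merge ha hab
  have ht' := F.sb.le_of_merge hb hab
  rw [sameCircle_iff] at hab'
  rcases hab' with hab' | hab'
  · have h₁ := F.sa.crossed_of_double_merge F.tb F.arc_b ha hab hab'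
    have h₂ := F.sb.crossed_of_double_merge F.ta F.arc_a hb hab.symm hab'.symm
    obtain ⟨e, he⟩ := exists_enumerates_append (s := s) [a, a'] (by simpa [circ_eq_iff] using ha)
    refine of_ones he fun φ ψ φ' ψ' hφ hψ hφ' hψ' => ?_
    have hbt : D.SameOriented t b b' :=
      (ht.symm.trans hta).trans (F.sa.le_of_merge ha hab')
    have hat' : D.SameOriented t' a a' :=
      (ht'.trans htb).trans (F.sb.le_of_merge hb hab').symm
    simp only [List.cons_append, List.nil_append]
    rw [hφ.map_merge F.sa ha, ones_congr₀ ht.sameCircle, hψ.map_split F.tb hbt,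
      ones_congr₀ hab.sameCircle, ones_congr₁ hab'.sameCircle, hφ'.map_merge F.sb hb,
      ones_congr₀ ht'.symm.sameCircle, hψ'.map_split F.ta hat', ones_swap₀ a a',
      ones_congr₀ h₁.symm.sameCircle, ones_congr₁ h₂.sameCircle, xMul_eq_of_sameOriented h₂,
      xMul_eq_of_sameOriented h₁, map_neg, map_neg]
    abel
  · intro φ ψ φ' ψ' hφ hψ hφ' hψ'
    rw [hψ.single ((ht.symm.trans hta).trans (F.sa.le_of_merge ha hab')),
      hψ'.single ((ht'.trans htb).trans
        (F.sb.le_of_merge hb (sameOriented_edge_left.1 hab'.symm)))]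
    simp

/-- The crossing at `b` splits a circle that does not pass through the crossing at `a`. -/
lemma merge_split_far (ha : ¬ D.SameCircle s a a') (hb : D.SameOriented s b b')
    (h₁ : ¬ D.SameCircle s a b) (h₂ : ¬ D.SameCircle s a' b) :
    D.FaceAnticommutes R s t t' u a a' b b' := by
  obtain ⟨e, he⟩ := exists_enumerates_append (s := s) [a, a', b] (by
    simp [circ_eq_iff, ha, h₁, h₂])
  refine of_ones he fun φ ψ φ' ψ' hφ hψ hφ' hψ' => ?_
  have ha' : ¬ D.SameCircle t' a a' := fun h =>
    ha (F.sb.inv.circle_le_of_merge (F.sb.not_sameCircle_of_split hb) h)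
  simp only [List.cons_append, List.nil_append]
  rw [hφ.map_merge F.sa ha, ones_swap₀, map_neg, hψ.map_split F.tb (F.sa.le_of_merge ha hb),
    ← ones_rotate b a a', hφ'.map_split F.sb hb, map_add, hψ'.comm, hψ'.comm,
    ones_swap_pairs b b', hψ'.map_merge F.ta ha', ones_rotate a b b']

/-- The crossing at `b` splits one of the two circles that merge at `a`; of the pieces, the one
through `b` passes through `a`. -/
lemma merge_split_near (ha : ¬ D.SameCircle s a a') (hb : D.SameOriented s b b')
    (hab : D.SameCircle t' a b) : D.FaceAnticommutes R s t t' u a a' b b' := by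
  obtain ⟨e, he⟩ := exists_enumerates_append (s := s) [a, a'] (by simpa [circ_eq_iff] using ha)
  refine of_ones he fun φ ψ φ' ψ' hφ hψ hφ' hψ' => ?_
  have hb' := F.sb.not_sameCircle_of_split hb
  have ha' : ¬ D.SameCircle t' a a' := fun h => ha (F.sb.inv.circle_le_of_merge hb' h)
  have hs := F.sb.inv.circle_le_of_merge hb' hab
  simp only [List.cons_append, List.nil_append]
  rw [hφ.map_merge F.sa ha, ones_congr₀ (F.sa.circle_le_of_merge ha hs),
    hψ.map_split F.tb (F.sa.le_of_merge ha hb), ones_congr₀ hs, hφ'.map_split F.sb hb, map_add,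
    hψ'.comm, hψ'.comm, ones_swap₁, ones_congr₀ hab.symm, map_neg, hψ'.map_merge F.ta ha',
    ones_congr₀ (F.ta.circle_le_of_merge ha' hab), map_neg, map_neg, neg_add, neg_neg, neg_neg]

/-- Two crossings that split two different circles. -/
lemma split_split_far (ha : D.SameOriented s a a') (hb : D.SameOriented s b b')
    (hab : ¬ D.SameCircle s a b) : D.FaceAnticommutes R s t t' u a a' b b' := by
  have key : ∀ {t a a' b b'}, D.Surgery s t a a' → D.SameOriented s a a' →
      D.SameOriented s b b' → ¬ D.SameCircle s a b → D.SameOriented t b b' := by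
    intro t a a' b b' S ha hb hab
    have hn := S.not_sameCircle_of_split ha
    have hle := fun {x y} => S.inv.circle_le_of_merge hn (x := x) (y := y)
    have h₁ : ¬ D.SameCircle t b a := fun h => hab (hle h).symm
    have h₂ : ¬ D.SameCircle t b a' := fun h => hab (ha.sameCircle.trans (hle h).symm)
    rw [S.inv.sameOriented_iff_of_merge hn] at hb
    rw [sameCircle_iff] at h₁ h₂
    tauto
  have hta := key F.sb hb ha fun h => hab h.symm
  have htb := key F.sa ha hb hab
  obtain ⟨e, he⟩ := exists_enumerates_append (s := s) [a, b] (by simpa [circ_eq_iff] using hab)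
  refine of_ones he fun φ ψ φ' ψ' hφ hψ hφ' hψ' => ?_
  simp only [List.cons_append, List.nil_append]
  rw [hφ.map_split F.sa ha, ← ones_rotate b a a', map_add, hψ.comm, hψ.comm,
    hψ.map_split F.tb htb, ones_swap₀ a b, map_neg, hφ'.map_split F.sb hb,
    ← ones_rotate (s := t') a b b', map_neg, map_add ψ', hψ'.comm, hψ'.comm,
    hψ'.map_split F.ta hta, ones_swap_pairs b b']
  simp only [map_add, xMul_comm a, xMul_comm a']
  abel

/-- Two crossings on one circle which both split this circle, in either order. -/
lemma split_split_near (ha : D.SameOriented s a a') (hb : D.SameOriented s b b')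
    (hta : D.SameOriented t' a a') (htb : D.SameOriented t b b') (hab : D.SameCircle t a b)
    (hu : D.SameCircle u a b) : D.FaceAnticommutes R s t t' u a a' b b' := by
  obtain ⟨e, he⟩ := exists_enumerates_append (s := s) [a] (by simp)
  refine of_ones he fun φ ψ φ' ψ' hφ hψ hφ' hψ' => ?_
  have hs := F.sa.inv.circle_le_of_merge (F.sa.not_sameCircle_of_split ha) hab
  have ht' := F.ta.inv.circle_le_of_merge (F.ta.not_sameCircle_of_split hta) hu
  simp only [List.cons_append, List.nil_append]
  rw [hφ.map_split F.sa ha, ones_congr₀ hab, map_add, hψ.comm, hψ.comm,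
    hψ.map_split F.tb htb, ones_congr₀ hs, hφ'.map_split F.sb hb, ones_congr₀ ht'.symm, map_add ψ',
    hψ'.comm, hψ'.comm, hψ'.map_split F.ta hta, ones_congr₀ hu, ones_swap₁ b a']
  simp only [map_add, map_neg, xMul_comm a, xMul_comm a']
  abel

/-- Two interleaved crossings on one circle: the first splits this circle, the second merges the
two pieces. -/
lemma split_merge (ha : D.SameOriented s a a') (hb : D.SameOriented s b b')
    (hab : D.SameOriented t a b) (hab' : D.SameOriented t a' b') :
    D.FaceAnticommutes R s t t' u a a' b b' := by
  have hta := F.sa.not_sameCircle_of_split ha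
  have htb : ¬ D.SameCircle t b b' := fun h =>
    hta ((hab.sameCircle.trans h).trans hab'.symm.sameCircle)
  have h₁ := F.inv.sa.crossed_of_double_merge F.inv.tb F.inv.arc_b hta hab hab'
  have h₂ := F.inv.sb.crossed_of_double_merge F.inv.ta F.inv.arc_a htb hab.symm hab'.symm
  have hta' : ¬ D.SameCircle t' a a' := fun h => F.sb.not_sameCircle_of_split hb
    ((h₁.sameCircle.trans h.symm).trans h₂.sameCircle)
  have hs := F.sa.inv.le_of_merge hta hab
  have hu := F.tb.le_of_merge htb hab
  have hu' := F.tb.le_of_merge htb hab'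
  obtain ⟨e, he⟩ := exists_enumerates_append (s := s) [a] (by simp)
  refine of_ones he fun φ ψ φ' ψ' hφ hψ hφ' hψ' => ?_
  simp only [List.cons_append, List.nil_append]
  rw [hφ.map_split F.sa ha, ones_congr₀ hab.sameCircle, ones_congr₁ hab'.sameCircle, map_add,
    hψ.comm, hψ.comm, hψ.map_merge F.tb htb, ones_congr₀ hs.sameCircle, hφ'.map_split F.sb hb,
    ones_congr₀ h₁.sameCircle, ones_congr₁ h₂.symm.sameCircle, ones_swap₀, map_add, hψ'.comm,
    hψ'.comm, map_neg, hψ'.map_merge F.ta hta', ones_congr₀ hu.sameCircle,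
    xMul_eq_of_sameOriented hu, xMul_eq_of_sameOriented hu', map_neg, map_neg]
  abel

/-- One of the two crossings gives a `1 → 1` bifurcation. -/
lemma single (ha : D.SameOriented s a (D.edge a')) : D.FaceAnticommutes R s t t' u a a' b b' := by
  intro φ ψ φ' ψ' hφ hψ hφ' hψ'
  rw [hφ.single ha, LinearMap.comp_zero, zero_add]
  by_cases hb : D.SameCircle s b b'
  · rcases sameCircle_iff.1 hb with hb | hb
    · have hn := F.sb.not_sameCircle_of_split hb
      by_cases hta : D.SameCircle t' a a'
      · rcases sameCircle_iff.1 hta with hta | hta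
        · exact absurd ha (not_edge_of_sameOriented (F.sb.inv.le_of_merge hn hta))
        · rw [hψ'.single hta, LinearMap.zero_comp]
      -- The two circles through `a` and `a'` in `t'` are those through `b` and `b'`; the surgery
      -- at `a` merges them with such orientations that `b` and `b'` become opposite.
      · have hu : D.SameOriented u b (D.edge b') := by
          have hm := F.ta.sameOriented_of_merge hta
          have hle := fun {x y} => F.ta.le_of_merge hta (x := x) (y := y)
          have hta₁ := mt sameCircle_iff.2 hta
          rw [F.sb.inv.sameOriented_iff_of_merge hn] at ha
          rcases ha with h | ⟨h | h, h' | h'⟩ | ⟨h | h, h' | h'⟩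
          · exact absurd (.inr h) hta₁
          · exact absurd (.inr (h.trans h'.symm)) hta₁
          · exact (hle h).symm.trans (hm.trans (hle (sameOriented_edge_left.1 h')))
          · have h₁ := (hle h).symm.trans (hm.trans (hle (sameOriented_edge_left.1 h')))
            exact sameOriented_edge_left.1 h₁.symm
          · exact absurd (.inr (h.trans h'.symm)) hta₁
          · exact absurd (.inr (h.trans h'.symm)) hta₁
          · have h₁ := (hle h).symm.trans (hm.trans (hle (sameOriented_edge_edge.1 h')))
            exact sameOriented_edge_left.1 h₁
          · have h₁ := (hle h).symm.trans (hm.trans (hle (sameOriented_edge_edge.1 h')))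
            exact h₁.symm
          · exact absurd (.inr (h.trans h'.symm)) hta₁
        obtain ⟨e, he⟩ := exists_enumerates_append (s := s) [b] (by simp)
        refine linearMap_ext_ones (ψ := 0) (fun h v => by simp [hφ'.comm, hψ'.comm])
          (fun h v => by simp) he ?_
        simp only [List.cons_append, List.nil_append]
        rw [LinearMap.comp_apply, hφ'.map_split F.sb hb, map_add, hψ'.comm, hψ'.comm,
          xMul_eq_neg hu]
        simp
    · rw [hφ'.single hb, LinearMap.comp_zero]
  · rw [hψ'.single (F.sb.le_of_merge hb ha), LinearMap.zero_comp]

lemma merge_merge (ha : ¬ D.SameCircle s a a') (hb : ¬ D.SameCircle s b b') :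
    D.FaceAnticommutes R s t t' u a a' b b' := by
  have key : ∀ {a a' b b'}, D.Face s t t' u a a' b b' → ¬ D.SameCircle s a a' →
      ¬ D.SameCircle s b b' → D.SameCircle s a b → D.FaceAnticommutes R s t t' u a a' b b' := by
    intro a a' b b' F ha hb hab
    by_cases hab' : D.SameCircle s a' b'
    · rcases sameCircle_iff.1 hab with h | h
      · exact merge_merge_double F ha h hab'
      · exact of_reverse' F (merge_merge_double F.flip.reverse.flip ha
          (sameOriented_arc_right.2 h) (hab'.trans (sameCircle_arc s b')))
    · exact merge_merge_near F ha hab (fun h => hb (h.trans hab).symm) fun h => hab' h.symm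
  have ha' : ¬ D.SameCircle s a' a := fun h => ha h.symm
  have hb' : ¬ D.SameCircle s b' b := fun h => hb h.symm
  by_cases h₁ : D.SameCircle s a b
  · exact key F ha hb h₁
  by_cases h₂ : D.SameCircle s a b'
  · exact of_swap' F (key F.flip.swap.flip ha hb' h₂)
  by_cases h₃ : D.SameCircle s a' b
  · exact of_swap F (key F.swap ha' hb h₃)
  by_cases h₄ : D.SameCircle s a' b'
  · exact of_swap F (of_swap' F.swap (key F.swap.flip.swap.flip ha' hb' h₄))
  · exact merge_merge_far F ha hb h₁ h₂ h₃ h₄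

lemma merge_split (ha : ¬ D.SameCircle s a a') (hb : D.SameOriented s b b') :
    D.FaceAnticommutes R s t t' u a a' b b' := by
  have key : ∀ {a a'}, D.Face s t t' u a a' b b' → ¬ D.SameCircle s a a' →
      D.SameCircle s a b → D.FaceAnticommutes R s t t' u a a' b b' := by
    intro a a' F ha hab
    have hn := F.sb.not_sameCircle_of_split hb
    rw [F.sb.inv.sameCircle_iff_of_merge hn] at hab
    rcases hab with h | ⟨h | h, -⟩
    · exact merge_split_near F ha hb h
    · exact merge_split_near F ha hb h
    · exact of_swap' F (merge_split_near F.flip.swap.flip ha hb.symm h)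
  by_cases h₁ : D.SameCircle s a b
  · exact key F ha h₁
  by_cases h₂ : D.SameCircle s a' b
  · exact of_swap F (key F.swap (fun h => ha h.symm) h₂)
  · exact merge_split_far F ha hb h₁ h₂

lemma split_split (ha : D.SameOriented s a a') (hb : D.SameOriented s b b') :
    D.FaceAnticommutes R s t t' u a a' b b' := by
  by_cases hab : D.SameCircle s a b
  swap
  · exact split_split_far F ha hb hab
  have hn := F.sa.not_sameCircle_of_split ha
  by_cases htb : D.SameCircle t b b'
  · replace htb : D.SameOriented t b b' := (sameCircle_iff.1 htb).resolve_right fun h =>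
      not_edge_of_sameOriented hb (F.sa.inv.le_of_merge hn h)
    have hun := F.tb.not_sameCircle_of_split htb
    have hta : D.SameOriented t' a a' := F.ta.inv.sameOriented_of_merge fun h =>
      hn (F.tb.inv.circle_le_of_merge hun h)
    have key : ∀ {a a'}, D.Face s t t' u a a' b b' → D.SameOriented s a a' →
        D.SameOriented t' a a' → D.SameCircle t a b →
        D.FaceAnticommutes R s t t' u a a' b b' := by
      intro a a' F ha hta hab
      have hab₁ := hab
      rw [F.tb.inv.sameCircle_iff_of_merge hun] at hab₁
      rcases hab₁ with h | ⟨h | h, -⟩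
      · exact split_split_near F ha hb hta htb hab h
      · exact split_split_near F ha hb hta htb hab h
      · exact of_swap' F (split_split_near F.flip.swap.flip ha hb.symm hta htb.symm
          (hab.trans htb.sameCircle) h)
    rw [F.sa.inv.sameCircle_iff_of_merge hn] at hab
    rcases hab with h | ⟨-, h | h⟩
    · exact key F ha hta h
    · exact key F ha hta h.symm
    · exact of_swap F (key F.swap ha.symm hta.symm h.symm)
  · have htb₁ := mt sameCircle_iff.2 htb
    have hb₁ := hb
    rw [F.sa.inv.sameOriented_iff_of_merge hn] at hb₁
    have arc_right : ∀ {x y}, y = b ∨ y = b' → D.SameOriented t y (D.edge x) →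
        D.SameOriented t x (D.arc s y) := by
      intro x y hy h
      rw [← F.arc_b y hy, sameOriented_arc_right]
      exact sameOriented_edge_left.1 h.symm
    have hb₂ := sameOriented_arc_arc.2 hb
    rcases hb₁ with h | ⟨h | h, h' | h'⟩ | ⟨h | h, h' | h'⟩
    · exact absurd (.inl h) htb₁
    · exact absurd (.inl (h.trans h'.symm)) htb₁
    · exact split_merge F ha hb h.symm h'.symm
    · exact of_swap' F (split_merge F.flip.swap.flip ha hb.symm h'.symm h.symm)
    · exact absurd (.inl (h.trans h'.symm)) htb₁
    · exact absurd (.inl (h.trans h'.symm)) htb₁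
    · exact of_reverse' F (split_merge F.flip.reverse.flip ha hb₂ (arc_right (.inl rfl) h)
        (arc_right (.inr rfl) h'))
    · exact of_reverse' F (of_swap' F.flip.reverse.flip (split_merge F.flip.reverse.swap.flip ha
        hb₂.symm (arc_right (.inr rfl) h') (arc_right (.inl rfl) h)))
    · exact absurd (.inl (h.trans h'.symm)) htb₁

theorem of_face : D.FaceAnticommutes R s t t' u a a' b b' := by
  by_cases ha : D.SameCircle s a a' <;> by_cases hb : D.SameCircle s b b'
  · rcases sameCircle_iff.1 ha with ha | ha
    · rcases sameCircle_iff.1 hb with hb | hb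
      · exact split_split F ha hb
      · exact of_flip (single F.flip hb)
    · exact single F ha
  · rcases sameCircle_iff.1 ha with ha | ha
    · exact of_flip (merge_split F.flip hb ha)
    · exact single F ha
  · rcases sameCircle_iff.1 hb with hb | hb
    · exact merge_split F ha hb
    · exact of_flip (single F.flip hb)
  · exact merge_merge F ha hb

end FaceAnticommutes

end VirtualDiagram

namespace VirtualDiagram

variable {D : VirtualDiagram} {s t u t' : D.State} {R : Type*} [Ring R] {a b c : Fin D.classical}
  {l : List (D.Half × Label)}

/-! ### The differential -/

lemma CubeEdge.unique (h : D.CubeEdge a s t) (h' : D.CubeEdge b s t) : a = b := by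
  by_contra hab
  have := h'.2.2 a hab
  rw [h.1, h.2.1] at this
  cases this

lemma CubeEdge.ne (h : D.CubeEdge a s t) (h' : D.CubeEdge b t u) : a ≠ b := by
  rintro rfl
  have := h.2.1.symm.trans h'.1
  cases this

lemma CubeEdge.height_eq (h : D.CubeEdge c s t) : D.height t = D.height s + 1 := by
  have : (Finset.univ.filter fun x => t x = .B) =
      insert c (Finset.univ.filter fun x => s x = .B) := by
    ext x
    rcases eq_or_ne x c with rfl | hx
    · simp [h.2.1]
    · simp [h.2.2 x hx, hx]
  rw [height, this, Finset.card_insert_of_notMem (by simp [h.1]), height]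

lemma arc_congr (h : s c = t c) {x : D.Half} (hx : x = D.first c ∨ x = D.second c) :
    D.arc s x = D.arc t x := by
  rcases hx with rfl | rfl <;> simp [first, second, arc, h]

lemma face_of_cubeEdge (hab : a ≠ b) (h₁ : D.CubeEdge a s t) (h₂ : D.CubeEdge b t u)
    (h₃ : D.CubeEdge b s t') (h₄ : D.CubeEdge a t' u) :
    D.Face s t t' u (D.first a) (D.second a) (D.first b) (D.second b) :=
  ⟨surgery_of_cubeEdge h₁, surgery_of_cubeEdge h₃, surgery_of_cubeEdge h₄, surgery_of_cubeEdge h₂,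
    fun _ => arc_congr (h₃.2.2 a hab), fun _ => arc_congr (h₁.2.2 b hab.symm)⟩

lemma exists_isCubeDifferential (R : Type*) [Ring R] (D : VirtualDiagram) :
    ∃ d : ∀ s t : D.State, D.StateSpace R s →ₗ[R] D.StateSpace R t,
      D.IsCubeDifferential R d := by
  classical
  refine ⟨fun s t => if h : ∃ c, D.CubeEdge c s t then
    (exists_isPartialDifferential R h.choose_spec).choose else 0, ?_, fun s t h => dif_neg h⟩
  intro c s t hc
  have h : ∃ c, D.CubeEdge c s t := ⟨c, hc⟩
  rw [dif_pos h, hc.unique h.choose_spec]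
  exact (exists_isPartialDifferential R h.choose_spec).choose_spec

namespace IsCubeDifferential

variable {d d' : ∀ s t : D.State, D.StateSpace R s →ₗ[R] D.StateSpace R t}

lemma isSurgeryMap (hd : D.IsCubeDifferential R d) (h : D.CubeEdge c s t) :
    D.IsSurgeryMap R s t (D.first c) (D.second c) (d s t) :=
  (hd.on_edge c s t h).isSurgeryMap (surgery_of_cubeEdge h)

lemma eq (hd : D.IsCubeDifferential R d) (hd' : D.IsCubeDifferential R d') : d = d' := by
  funext s t
  by_cases h : ∃ c, D.CubeEdge c s t
  · obtain ⟨c, hc⟩ := h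
    exact (hd.isSurgeryMap hc).eq (hd'.isSurgeryMap hc)
  · rw [hd.off_edge s t h, hd'.off_edge s t h]

lemma anticomm (hd : D.IsCubeDifferential R d) (hab : a ≠ b) (h₁ : D.CubeEdge a s t)
    (h₂ : D.CubeEdge b t u) (h₃ : D.CubeEdge b s t') (h₄ : D.CubeEdge a t' u) :
    d t u ∘ₗ d s t + d t' u ∘ₗ d s t' = 0 :=
  FaceAnticommutes.of_face (face_of_cubeEdge hab h₁ h₂ h₃ h₄) _ _ _ _ (hd.isSurgeryMap h₁)
    (hd.isSurgeryMap h₂) (hd.isSurgeryMap h₃) (hd.isSurgeryMap h₄)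

/-- The two paths of length two between two given states cancel. -/
lemma sum_comp_eq_zero (hd : D.IsCubeDifferential R d) (s u : D.State) :
    ∑ t, d t u ∘ₗ d s t = 0 := by
  classical
  let P : D.State → Prop := fun t => (∃ a, D.CubeEdge a s t) ∧ ∃ b, D.CubeEdge b t u
  have hP : ∀ t ∈ Finset.univ, d t u ∘ₗ d s t ≠ 0 → P t := by
    intro t _ ht
    refine ⟨?_, ?_⟩ <;> by_contra h
    · exact ht (by rw [hd.off_edge s t h, LinearMap.comp_zero])
    · exact ht (by rw [hd.off_edge t u h, LinearMap.zero_comp])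
  rw [← Finset.sum_filter_of_ne hP]
  -- The other path changes the two smoothings in the opposite order.
  let g : D.State → D.State := fun t x => if t x = s x then u x else s x
  have hg : ∀ {t a b}, D.CubeEdge a s t → D.CubeEdge b t u →
      D.CubeEdge b s (g t) ∧ D.CubeEdge a (g t) u := by
    intro t a b h₁ h₂
    have hab := h₁.ne h₂
    have hb : t b = s b := h₁.2.2 b hab.symm
    have ha : t a ≠ s a := by rw [h₁.1, h₁.2.1]; simp
    refine ⟨⟨hb ▸ h₂.1, ?_, fun x hx => ?_⟩, ?_, ?_, fun x hx => ?_⟩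
    · simp only [g, if_pos hb, h₂.2.1]
    · simp only [g]
      split_ifs with h
      · rw [h₂.2.2 x hx, h]
      · rfl
    · simp only [g, if_neg ha, h₁.1]
    · rw [h₂.2.2 a hab, h₁.2.1]
    · simp only [g, if_pos (h₁.2.2 x hx)]
  refine Finset.sum_involution (fun t _ => g t) ?_ ?_ ?_ ?_
  · intro t ht
    obtain ⟨⟨a, h₁⟩, b, h₂⟩ := (Finset.mem_filter.1 ht).2
    exact hd.anticomm (h₁.ne h₂) h₁ h₂ (hg h₁ h₂).1 (hg h₁ h₂).2
  · intro t ht _ hgt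
    obtain ⟨⟨a, h₁⟩, b, h₂⟩ := (Finset.mem_filter.1 ht).2
    have h₃ := (hg h₁ h₂).1
    rw [hgt] at h₃
    exact h₁.ne h₂ (h₁.unique h₃)
  · intro t ht
    obtain ⟨⟨a, h₁⟩, b, h₂⟩ := (Finset.mem_filter.1 ht).2
    exact Finset.mem_filter.2 ⟨Finset.mem_univ _, ⟨b, (hg h₁ h₂).1⟩, a, (hg h₁ h₂).2⟩
  · intro t ht
    obtain ⟨⟨a, h₁⟩, b, h₂⟩ := (Finset.mem_filter.1 ht).2
    funext x
    by_cases hx : x = a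
    · subst hx
      have ha : t x ≠ s x := by rw [h₁.1, h₁.2.1]; simp
      simp only [g, if_neg ha, if_true, h₂.2.2 x (h₁.ne h₂)]
    · have ha := h₁.2.2 x hx
      have hgx : g t x = u x := if_pos ha
      change (if g t x = s x then u x else s x) = t x
      rw [hgx, ha]
      split_ifs with h
      exacts [h, rfl]

lemma inclusion_mem (hd : D.IsCubeDifferential R d) (t : D.State)
    (hl : D.Enumerates s (l.map Prod.fst)) :
    D.inclusion R t (d s t (D.wedge R s l)) ∈
      D.bigradedPiece R (D.height s + 1) (D.grading s l) := by
  by_cases h : ∃ c, D.CubeEdge c s t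
  swap
  · rw [hd.off_edge s t h, LinearMap.zero_apply, map_zero]
    exact zero_mem _
  obtain ⟨c, hc⟩ := h
  have hφ := hd.on_edge c s t hc
  have S := surgery_of_cubeEdge hc
  have mem : ∀ l' : List (D.Half × Label), D.Enumerates t (l'.map Prod.fst) →
      D.grading t l' = D.grading s l → D.inclusion R t (D.wedge R t l') ∈
        D.bigradedPiece R (D.height s + 1) (D.grading s l) := fun l' h₁ h₂ =>
    Submodule.subset_span ⟨t, l', h₁, hc.height_eq, h₂, rfl⟩
  have grading_cons : ∀ (r : D.State) (h : D.Half) (i : Label) (l : List (D.Half × Label)),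
      D.grading r ((h, i) :: l) = D.grading r l + if i = .one then 1 else -1 := by
    intro r h i l
    cases i <;> simp [grading] <;> ring
  have grading_eq : ∀ l : List (D.Half × Label), D.grading t l = D.grading s l + 1 := by
    intro l
    simp only [grading, hc.height_eq]
    push_cast
    ring
  by_cases h₁ : D.SameCircle s (D.first c) (D.second c)
  · rcases sameCircle_iff.1 h₁ with h₂ | h₂
    · have hn := S.not_sameCircle_of_split h₂
      have hm := hφ.one_two h₁ hn
      obtain ⟨e, he⟩ := exists_enumerates_append (s := s) [D.first c] (by simp)
      obtain ⟨l', ε, hl', hε⟩ := RelStar.exists_normalForm l _ (hl.map_perm he)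
      obtain ⟨i, l', rfl, hl₁⟩ := exists_cons_of_map_fst_eq_cons hl'
      change _ = e at hl₁
      subst hl₁
      have het : D.Enumerates t (D.first c :: D.second c :: l'.map Prod.fst) :=
        (S.inv.enumerates_iff_of_merge hn).1 he
      rw [hε.wedge_eq, map_zsmul, map_zsmul]
      refine zsmul_mem ?_ ε
      rw [grading_eq_of_labels_perm hε.labels_perm] at mem ⊢
      cases i
      · rw [hm.one l' he, map_add]
        exact add_mem (mem _ het (by simp [grading_cons, grading_eq]))
          (mem _ het (by simp [grading_cons, grading_eq]))
      · rw [hm.X l' he]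
        exact mem _ het (by simp [grading_cons, grading_eq])
    · rw [hφ.one_one h₁ (sameCircle_iff.2 (.inr (S.sameOriented_edge_of_single h₂))),
        LinearMap.zero_apply, map_zero]
      exact zero_mem _
  · have hm := hφ.two_one h₁ (S.sameOriented_of_merge h₁).sameCircle
    obtain ⟨e, he⟩ := exists_enumerates_append (s := s) [D.first c, D.second c]
      (by simpa [circ_eq_iff] using h₁)
    obtain ⟨l', ε, hl', hε⟩ := RelStar.exists_normalForm l _ (hl.map_perm he)
    obtain ⟨i, l', rfl, hl₁⟩ := exists_cons_of_map_fst_eq_cons hl'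
    obtain ⟨j, l', rfl, hl₂⟩ := exists_cons_of_map_fst_eq_cons hl₁
    change _ = e at hl₂
    subst hl₂
    have het : D.Enumerates t (D.first c :: l'.map Prod.fst) :=
      (S.enumerates_iff_of_merge h₁).2 he
    rw [hε.wedge_eq, map_zsmul, map_zsmul]
    refine zsmul_mem ?_ ε
    rw [grading_eq_of_labels_perm hε.labels_perm] at mem ⊢
    cases i <;> cases j
    · rw [hm.one_one l' he]
      exact mem _ het (by simp [grading_cons, grading_eq])
    · rw [hm.one_X l' he]
      exact mem _ het (by simp [grading_cons, grading_eq])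
    · rw [hm.X_one l' he]
      exact mem _ het (by simp [grading_cons, grading_eq])
    · rw [hm.X_X l' he, map_zero]
      exact zero_mem _

lemma boundary_inclusion (d : ∀ s t : D.State, D.StateSpace R s →ₗ[R] D.StateSpace R t)
    (s : D.State) (v : D.StateSpace R s) :
    D.boundary R d (D.inclusion R s v) = ∑ t, D.inclusion R t (d s t v) := by
  rw [boundary, inclusion, DirectSum.toModule_lof, LinearMap.sum_apply]
  rfl

lemma boundary_comp_boundary (hd : D.IsCubeDifferential R d) :
    D.boundary R d ∘ₗ D.boundary R d = 0 := by
  refine DirectSum.linearMap_ext R fun s => LinearMap.ext fun v => ?_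
  change D.boundary R d (D.boundary R d (D.inclusion R s v)) = 0
  rw [boundary_inclusion, map_sum]
  simp only [boundary_inclusion]
  rw [Finset.sum_comm]
  refine Finset.sum_eq_zero fun u _ => ?_
  rw [← map_sum]
  have := LinearMap.congr_fun (hd.sum_comp_eq_zero s u) v
  simp only [LinearMap.sum_apply, LinearMap.comp_apply, LinearMap.zero_apply] at this
  rw [this, map_zero]

lemma boundary_mem (hd : D.IsCubeDifferential R d) {i : ℕ} {j : ℤ} {x : D.Chains R}
    (hx : x ∈ D.bigradedPiece R i j) : D.boundary R d x ∈ D.bigradedPiece R (i + 1) j := by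
  suffices D.bigradedPiece R i j ≤ (D.bigradedPiece R (i + 1) j).comap (D.boundary R d) from
    this hx
  refine Submodule.span_le.2 ?_
  rintro _ ⟨s, l, hl, rfl, rfl, rfl⟩
  rw [SetLike.mem_coe, Submodule.mem_comap, boundary_inclusion]
  exact sum_mem fun t _ => hd.inclusion_mem t hl

end IsCubeDifferential

end VirtualDiagram

theorem mainTheorem1 (R : Type*) [Ring R] (D : VirtualDiagram) :
    -- the labelled monomials, for any order and orientations of the circles, form a basis
    (∀ (s : D.State) (e : List D.Half), D.Enumerates s e →
      LinearIndependent R (fun p : Fin e.length → Label =>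
        D.wedge R s (List.ofFn fun i => (e.get i, p i))) ∧
      Submodule.span R (Set.range fun p : Fin e.length → Label =>
        D.wedge R s (List.ofFn fun i => (e.get i, p i))) = ⊤) ∧
    -- the chain space is the direct sum of its bigraded pieces
    DirectSum.IsInternal (fun ij : ℕ × ℤ => D.bigradedPiece R ij.1 ij.2) ∧
    -- bifurcations are 2 → 1, 1 → 2 or 1 → 1, and except in the last case a circle that passes
    -- twice through the crossing gets the same local orientation from both arcs
    (∀ c s t, D.CubeEdge c s t →
      (D.OneCircleAt c s ∨ D.OneCircleAt c t) ∧
      (D.OneCircleAt c s → ¬ D.OneCircleAt c t → D.SameOriented s (D.first c) (D.second c)) ∧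
      (¬ D.OneCircleAt c s → D.OneCircleAt c t → D.SameOriented t (D.first c) (D.second c))) ∧
    -- the partial differentials exist and are unique, all 2-faces anticommute, and the sum of the
    -- partial differentials is a differential of bidegree (1, 0)
    ∃ d : ∀ s t : D.State, D.StateSpace R s →ₗ[R] D.StateSpace R t,
      D.IsCubeDifferential R d ∧
      (∀ d', D.IsCubeDifferential R d' → d' = d) ∧
      (∀ a b s t t' u, a ≠ b → D.CubeEdge a s t → D.CubeEdge b t u →
        D.CubeEdge b s t' → D.CubeEdge a t' u →
        (d t u) ∘ₗ (d s t) + (d t' u) ∘ₗ (d s t') = 0) ∧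
      (D.boundary R d) ∘ₗ (D.boundary R d) = 0 ∧
      (∀ i j x, x ∈ D.bigradedPiece R i j → D.boundary R d x ∈ D.bigradedPiece R (i + 1) j) := by
  refine ⟨fun s e he => ⟨VirtualDiagram.linearIndependent_wedge he, VirtualDiagram.span_wedge he⟩,
    VirtualDiagram.isInternal_bigradedPiece R D, fun c s t h => ?_, ?_⟩
  · have S := VirtualDiagram.surgery_of_cubeEdge h
    refine ⟨?_, fun _ h' => ?_, fun h' _ => S.sameOriented_of_merge h'⟩
    · by_contra hn
      rw [not_or] at hn
      exact hn.2 (S.sameOriented_of_merge hn.1).sameCircle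
    · exact S.inv.sameOriented_of_merge h'
  · obtain ⟨d, hd⟩ := VirtualDiagram.exists_isCubeDifferential R D
    exact ⟨d, hd, fun d' hd' => hd'.eq hd, fun a b s t t' u hab h₁ h₂ h₃ h₄ =>
      hd.anticomm hab h₁ h₂ h₃ h₄, hd.boundary_comp_boundary, fun i j x hx => hd.boundary_mem hx⟩
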